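/- **Setting.** Let $\mathcal H$ be a complex Hilbert space, $(x,y)$ its inner product (linear in $x$), $\omega>0$, $k>1$ an integer, $\theta\in\{0,1\}$. Let $(e_j)_{j\in\mathbb Z}$ be an orthonormal basis of $\mathcal H$ and $A_\theta:D(A_\theta)\subset\mathcal H\to\mathcal H$ a normal operator with $A_\theta e_j=\pi^{2k}(2j+\theta)^{2k}\omega^{-2k}e_j$, $j\in\mathbb Z$. For $n\ge 0$ put $\lambda_n=\pi^{2k}(2n+\theta)^{2k}/\omega^{2k}$ and let $\mathbb P_n$ be the orthogonal projection onto $\mathrm{span}\{e_{-n-\theta},e_n\}$ (the eigenspace of $A_\theta$ for $\lambda_n$); $\mathbb P_{(m)}=\sum_{j=0}^m\mathbb P_j$. Let $\|X\|_2=\big(\sum_{i,j\in\mathbb Z}|(Xe_i,e_j)|^2\big)^{1/2}$ be the Hilbert–Schmidt norm. For Hilbert–Schmidt $X$ put $$JX=\sum_{n\ge0}\mathbb P_nX\mathbb P_n,\qquad \Gamma X=\sum_{s,j\ge 0,\ \lambda_s\ne\lambda_j}\frac{\mathbb P_sX\mathbb P_j}{\lambda_s-\lambda_j},$$ $$J_mX=J(X-\mathbb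 P_{(m)}X\mathbb P_{(m)})+\mathbb P_{(m)}X\mathbb P_{(m)},\qquad \Gamma_mX=\Gamma(X-\mathbb P_{(m)}X\mathbb P_{(m)}).$$ **Theorem.** Let $B$ be a Hilbert–Schmidt operator on $\mathcal H$ and let the integer $m\ge0$ satisfy $2m+\theta>0$ and $$\frac{\omega^{2k}\|B\|_2}{\pi^{2k}(2m+1)(2m+\theta)^{2k-2}}<1 .$$ Then the equation $$X=B\,\Gamma_mX-(\Gamma_mX)(J_mB)-(\Gamma_mX)J_m(B\,\Gamma_mX)+B$$ has exactly one Hilbert–Schmidt solution $X=X_*$ with $\|X_*-B\|_2\le3\|B\|_2$. Let $\sigma_{(m)}$ be the spectrum of the restriction of $A_\theta-\mathbb P_{(m)}X_*\mathbb P_{(m)}$ to $\mathrm{Im}\,\mathbb P_{(m)}$ and, for $n\ge m+1$, let $\sigma_n$ be the spectrum of the restriction of $A_\theta-\mathbb P_nX_*\mathbb P_n$ to $\mathrm{Im}\,\mathbb P_n$. Then $$\sigma(A_\theta-B)=\sigma_{(m)}\cup\bigcup_{n\ge m+1}\sigma_n ,$$ the sets $\sigma_{(m)}$ and $\sigma_n$,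 $n\ge m+1$, are mutually disjoint, $\sigma_{(m)}$ has at most $2m+1+\theta$ points and each $\sigma_n$, $n\ge m+1$, has at most two points. Moreover, for every $n\ge m+1$ there is a $2\times2$ matrix $\mathcal C_n$ such that $\sigma_n$ is the spectrum of the matrix $$\mathcal A_n=\lambda_nI-\mathcal B_n+\mathcal C_n,\qquad \mathcal B_n=\begin{pmatrix}(Be_{-n-\theta},e_{-n-\theta})&(Be_n,e_{-n-\theta})\\(Be_{-n-\theta},e_n)&(Be_n,e_n)\end{pmatrix},$$ and, whenever $n\ge\max\{m+1,\,(3\|B\|_2\,\omega^{2k}\pi^{-2k}/2)^{1/(2k-1)}\}$, $$\|\mathcal C_n\|_2\le\frac{\omega^{2k}}{2\pi^{2k}n(2n+\theta)^{2k-2}}\,\|\mathbb P_nB-\mathbb P_nB\mathbb P_n\|_2\,\|B\mathbb P_n-\mathbb P_nB\mathbb P_n\|_2 .$$ -/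

import Mathlib

open scoped InnerProductSpace

noncomputable section

namespace SimilarOperators

/-! ### Unbounded operators -/

section Unbounded

variable {E : Type*} [NormedAddCommGroup E] [NormedSpace ℂ E]

/-- `z` lies in the resolvent set of the (possibly unbounded) operator `T : D(T) ⊂ E → E`:
`T - z` maps `D(T)` bijectively onto `E`, with a bounded everywhere defined inverse `R`. -/
def InResolventSet (T : E →ₗ.[ℂ] E) (z : ℂ) : Prop :=
  ∃ R : E →L[ℂ] E,
    (∀ y : E, ∃ h : R y ∈ T.domain, T ⟨R y, h⟩ - z • R y = y) ∧
    ∀ x : T.domain, R (T x - z • (x : E)) = x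

/-- The spectrum of a (possibly unbounded) operator. -/
def pSpectrum (T : E →ₗ.[ℂ] E) : Set ℂ := {z | ¬ InResolventSet T z}

/-- The operator `T - X` with domain `D(T)`, for `X` bounded. -/
def subBounded (T : E →ₗ.[ℂ] E) (X : E →L[ℂ] E) : E →ₗ.[ℂ] E where
  domain := T.domain
  toFun := T.toFun - (X : E →ₗ[ℂ] E) ∘ₗ T.domain.subtype

/-- The restriction of the operator `T` to a subspace `S`, as an operator in `S`; its domain is
`{x ∈ S ∩ D(T) : T x ∈ S}`, which is `S ∩ D(T)` when `S` is invariant. -/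
def restrictTo (T : E →ₗ.[ℂ] E) (S : Submodule ℂ E) : S →ₗ.[ℂ] S where
  domain :=
    { carrier := {x | ∃ h : (x : E) ∈ T.domain, T ⟨x, h⟩ ∈ S}
      zero_mem' := ⟨T.domain.zero_mem, by
        have h : T ⟨((0 : S) : E), T.domain.zero_mem⟩ = 0 := T.map_zero
        rw [h]; exact S.zero_mem⟩
      add_mem' := by
        rintro x y ⟨hx, hx'⟩ ⟨hy, hy'⟩
        refine ⟨T.domain.add_mem hx hy, ?_⟩
        have h : T ⟨((x + y : S) : E), T.domain.add_mem hx hy⟩ = T ⟨x, hx⟩ + T ⟨y, hy⟩ :=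
          T.map_add ⟨x, hx⟩ ⟨y, hy⟩
        rw [h]; exact S.add_mem hx' hy'
      smul_mem' := by
        rintro c x ⟨hx, hx'⟩
        refine ⟨T.domain.smul_mem c hx, ?_⟩
        have h : T ⟨((c • x : S) : E), T.domain.smul_mem c hx⟩ = c • T ⟨x, hx⟩ :=
          T.map_smul c ⟨x, hx⟩
        rw [h]; exact S.smul_mem c hx' }
  toFun :=
    { toFun := fun x => ⟨T ⟨((x : S) : E), x.2.choose⟩, x.2.choose_spec⟩
      map_add' := fun x y => Subtype.ext
        (T.map_add ⟨((x : S) : E), x.2.choose⟩ ⟨((y : S) : E), y.2.choose⟩)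
      map_smul' := fun c x => Subtype.ext (T.map_smul c ⟨((x : S) : E), x.2.choose⟩) }

end Unbounded

variable {H : Type*} [NormedAddCommGroup H] [InnerProductSpace ℂ H] [CompleteSpace H]

/-- A densely defined closed operator `T` in a Hilbert space is normal if `D(T) = D(T*)` and
`‖T x‖ = ‖T* x‖` on this common domain. -/
def IsNormalOp (T : H →ₗ.[ℂ] H) : Prop :=
  Dense (T.domain : Set H) ∧ T.IsClosed ∧ T.domain = T.adjoint.domain ∧
    ∀ (x : H) (h : x ∈ T.domain) (h' : x ∈ T.adjoint.domain), ‖T ⟨x, h⟩‖ = ‖T.adjoint ⟨x, h'⟩‖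

/-! ### Hilbert-Schmidt operators -/

section HilbertSchmidt

variable {ι : Type*}

/-- `X` is a Hilbert-Schmidt operator: `∑_{i,j} |(X g_i, g_j)|² < ∞`. -/
def IsHilbertSchmidt (g : HilbertBasis ι ℂ H) (X : H →L[ℂ] H) : Prop :=
  Summable fun p : ι × ι => ‖⟪g p.2, X (g p.1)⟫_ℂ‖ ^ 2

/-- The Hilbert-Schmidt norm `‖X‖₂ = (∑_{i,j} |(X g_i, g_j)|²)^{1/2}`. -/
def hsNorm (g : HilbertBasis ι ℂ H) (X : H →L[ℂ] H) : ℝ :=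
  √(∑' p : ι × ι, ‖⟪g p.2, X (g p.1)⟫_ℂ‖ ^ 2)

end HilbertSchmidt

/-- The Hilbert-Schmidt norm of a `2 × 2` matrix. -/
def matHSNorm (C : Matrix (Fin 2) (Fin 2) ℂ) : ℝ := √(∑ i, ∑ j, ‖C i j‖ ^ 2)

/-! ### The unperturbed operator and the transformers -/

/-- `π^{2k} (2j + θ)^{2k} / ω^{2k}`. -/
def lam (ω : ℝ) (k θ : ℕ) (j : ℤ) : ℝ :=
  Real.pi ^ (2 * k) * (2 * (j : ℝ) + θ) ^ (2 * k) / ω ^ (2 * k)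

/-- `A` is a normal operator for which the orthonormal basis `(e_j)`, `j ∈ ℤ`, consists of
eigenvectors: `A e_j = π^{2k} (2j + θ)^{2k} / ω^{2k} • e_j`. The vectors `e_n` and `e_{-n-θ}`
belong to the same eigenvalue. -/
def IsUnperturbed (ω : ℝ) (k θ : ℕ) (e : HilbertBasis ℤ ℂ H) (A : H →ₗ.[ℂ] H) : Prop :=
  IsNormalOp A ∧
    ∀ j : ℤ, ∃ h : e j ∈ A.domain, A ⟨e j, h⟩ = ((lam ω k θ j : ℝ) : ℂ) • e j

/-- The orthogonal projection `ℙ_n x = (x, e_{-n-θ}) e_{-n-θ} + (x, e_n) e_n`, and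
`ℙ_0 x = (x, e_0) e_0` if `θ = 0` (the index set is then the singleton `{0}`). -/
def projN (θ : ℕ) (e : HilbertBasis ℤ ℂ H) (n : ℕ) : H →L[ℂ] H :=
  ∑ j ∈ ({-(n : ℤ) - θ, (n : ℤ)} : Finset ℤ), InnerProductSpace.rankOne ℂ (e j) (e j)

/-- `ℙ_(m) = ∑_{j=0}^m ℙ_j`. -/
def projUpTo (θ : ℕ) (e : HilbertBasis ℤ ℂ H) (m : ℕ) : H →L[ℂ] H :=
  ∑ j ∈ Finset.range (m + 1), projN θ e j

/-- `J X = ∑_n ℙ_n X ℙ_n`. For `X` Hilbert-Schmidt the series converges unconditionally in the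
Hilbert-Schmidt norm, hence also in the operator norm, in which the sum is taken here. -/
def transJ (θ : ℕ) (e : HilbertBasis ℤ ℂ H) (X : H →L[ℂ] H) : H →L[ℂ] H :=
  ∑' n : ℕ, projN θ e n ∘L X ∘L projN θ e n

open scoped Classical in
/-- `Γ X = ∑_{λ_s ≠ λ_j} ℙ_s X ℙ_j / (λ_s - λ_j)`, where `λ_n = π^{2k} (2n + θ)^{2k} / ω^{2k}`,
`n ≥ 0`; the convergence is as for `J`. -/
def transΓ (ω : ℝ) (k θ : ℕ) (e : HilbertBasis ℤ ℂ H) (X : H →L[ℂ] H) : H →L[ℂ] H :=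
  ∑' p : ℕ × ℕ, if lam ω k θ p.1 ≠ lam ω k θ p.2 then
    (((lam ω k θ p.1 - lam ω k θ p.2)⁻¹ : ℝ) : ℂ) • (projN θ e p.1 ∘L X ∘L projN θ e p.2) else 0

/-- `J_m X = J (X - ℙ_(m) X ℙ_(m)) + ℙ_(m) X ℙ_(m)`. -/
def transJm (θ : ℕ) (e : HilbertBasis ℤ ℂ H) (m : ℕ) (X : H →L[ℂ] H) : H →L[ℂ] H :=
  transJ θ e (X - projUpTo θ e m ∘L X ∘L projUpTo θ e m) +
    projUpTo θ e m ∘L X ∘L projUpTo θ e m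

/-- `Γ_m X = Γ (X - ℙ_(m) X ℙ_(m))`. -/
def transΓm (ω : ℝ) (k θ : ℕ) (e : HilbertBasis ℤ ℂ H) (m : ℕ) (X : H →L[ℂ] H) : H →L[ℂ] H :=
  transΓ ω k θ e (X - projUpTo θ e m ∘L X ∘L projUpTo θ e m)

/-- `Φ(X) = B Γ_m X - (Γ_m X)(J_m B) - (Γ_m X) J_m(B Γ_m X) + B`. -/
def mapΦ (ω : ℝ) (k θ : ℕ) (e : HilbertBasis ℤ ℂ H) (m : ℕ) (B X : H →L[ℂ] H) : H →L[ℂ] H :=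
  B ∘L transΓm ω k θ e m X - transΓm ω k θ e m X ∘L transJm θ e m B -
    transΓm ω k θ e m X ∘L transJm θ e m (B ∘L transΓm ω k θ e m X) + B

/-- `X` is a Hilbert-Schmidt solution of `X = Φ(X)` in the ball `‖X - B‖₂ ≤ 3 ‖B‖₂`. -/
def IsSolution (ω : ℝ) (k θ : ℕ) (e : HilbertBasis ℤ ℂ H) (m : ℕ) (B X : H →L[ℂ] H) : Prop :=
  IsHilbertSchmidt e X ∧ hsNorm e (X - B) ≤ 3 * hsNorm e B ∧ X = mapΦ ω k θ e m B X

/-! ### The pieces of the spectrum -/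

/-- The spectrum of the restriction of `A - P X P` to the subspace `Im P`. -/
def compressedSpectrum (A : H →ₗ.[ℂ] H) (P X : H →L[ℂ] H) : Set ℂ :=
  pSpectrum (restrictTo (subBounded A (P ∘L X ∘L P)) (LinearMap.range (P : H →ₗ[ℂ] H)))

/-- `σ_(m)`, the spectrum of the restriction of `A - ℙ_(m) X ℙ_(m)` to `Im ℙ_(m)`. -/
def sigmaLow (θ : ℕ) (e : HilbertBasis ℤ ℂ H) (A : H →ₗ.[ℂ] H) (X : H →L[ℂ] H) (m : ℕ) : Set ℂ :=
  compressedSpectrum A (projUpTo θ e m) X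

/-- `σ_n`, the spectrum of the restriction of `A - ℙ_n X ℙ_n` to `Im ℙ_n`. -/
def sigmaN (θ : ℕ) (e : HilbertBasis ℤ ℂ H) (A : H →ₗ.[ℂ] H) (X : H →L[ℂ] H) (n : ℕ) : Set ℂ :=
  compressedSpectrum A (projN θ e n) X

/-- The matrix `((B e_{-n-θ}, e_{-n-θ}), (B e_n, e_{-n-θ}); (B e_{-n-θ}, e_n), (B e_n, e_n))`. -/
def matB (θ : ℕ) (e : HilbertBasis ℤ ℂ H) (B : H →L[ℂ] H) (n : ℕ) :
    Matrix (Fin 2) (Fin 2) ℂ :=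
  !![⟪e (-(n : ℤ) - θ), B (e (-(n : ℤ) - θ))⟫_ℂ, ⟪e (-(n : ℤ) - θ), B (e n)⟫_ℂ;
     ⟪e n, B (e (-(n : ℤ) - θ))⟫_ℂ, ⟪e n, B (e n)⟫_ℂ]

end SimilarOperators

end

/-! This is the method of similar operators. The entries of `Γ_m X` are those of `X` outside the
diagonal blocks divided by `λ_i - λ_j`, so `A (Γ_m X) - (Γ_m X) A = X - J_m X`. A block diagonal
operator multiplied by `Γ_m X` has zero diagonal blocks; hence applying `J_m` to the nonlinear
equation gives `J_m X = J_m B + J_m (B Γ_m X)`, and the equation becomes `B (1 + Γ_m X) = X + (Γ_m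
X)(J_m X)`. Together these say `(A - B)(1 + Γ_m X) = (1 + Γ_m X)(A - J_m X)`. If `‖Γ_m X‖ < 1`, then
`A - B` is similar to a block diagonal operator, whose spectrum is the union of the spectra of its
blocks.

The numerical hypothesis says `8 ‖B‖₂ < gapBound`, a lower bound for the distance between
eigenvalues of different blocks. In the ball `‖X‖₂ ≤ 4 ‖B‖₂`, so `‖Γ_m X‖₂ ≤ 1/2` and the equation
is a contraction (`mapΦ_maps_ball`, `mapΦ_lipschitz`, `existsUnique_fixedPoint`). The same constant
separates the blocks: the spectrum of each lies within `‖X‖ ≤ 4 ‖B‖₂` of its unperturbed eigenvalues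
(`exists_near`, `disjoint_blocks`).

Similarity of unbounded operators is handled through eigenvectors. Compactness of the resolvent of
`A` makes the spectrum of every bounded perturbation consist of eigenvalues
(`pSpectrum_subBounded`), and `exists_eigenvector_iff_of_similar` transports eigenvectors through `1
+ Γ_m X`.

Finally `C_n` is the matrix of `-ℙ_n B Γ_m X ℙ_n`. As `ℙ_n Γ_m X ℙ_n = 0`, this equals `-(ℙ_n B -
ℙ_n B ℙ_n)(Γ_m X ℙ_n)`, and the last factor is estimated by multiplying the equation by `ℙ_n` on the
right (`hsNorm_transΓm_comp_projN_le`). -/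

noncomputable section

namespace SimilarOperators

/-! ### Vectors and operators determined by their coordinates. -/

section HilbertBasisCoordinates

variable {ι : Type*} {H : Type*} [NormedAddCommGroup H] [InnerProductSpace ℂ H]

theorem hasSum_norm_inner_sq (g : HilbertBasis ι ℂ H) (v : H) :
    HasSum (fun i => ‖⟪g i, v⟫_ℂ‖ ^ 2) (‖v‖ ^ 2) := by
  have h := g.hasSum_inner_mul_inner v v
  rw [inner_self_eq_norm_sq_to_K] at h
  rw [← Complex.hasSum_ofReal]
  have h2 : ∀ i, ⟪v, g i⟫_ℂ * ⟪g i, v⟫_ℂ = ((‖⟪g i, v⟫_ℂ‖ ^ 2 : ℝ) : ℂ) := fun i => by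
    rw [← inner_conj_symm v (g i), mul_comm, RCLike.mul_conj]
    push_cast
    rfl
  simp only [h2] at h
  push_cast at h ⊢
  exact h

theorem ext_inner_basis (g : HilbertBasis ι ℂ H) {u v : H} (h : ∀ i, ⟪g i, u⟫_ℂ = ⟪g i, v⟫_ℂ) :
    u = v := by
  have h2 := hasSum_norm_inner_sq g (u - v)
  have h3 : (fun i => ‖⟪g i, u - v⟫_ℂ‖ ^ 2) = fun _ => 0 := by
    funext i; simp [h i]
  rw [h3] at h2
  have := h2.unique hasSum_zero
  rwa [sq_eq_zero_iff, norm_eq_zero, sub_eq_zero] at this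

theorem norm_le_of_norm_inner_le (g : HilbertBasis ι ℂ H) {u v : H} {c : ℝ} (hc : 0 ≤ c)
    (h : ∀ i, ‖⟪g i, u⟫_ℂ‖ ≤ c * ‖⟪g i, v⟫_ℂ‖) : ‖u‖ ≤ c * ‖v‖ := by
  have h1 := hasSum_norm_inner_sq g u
  have h2 := (hasSum_norm_inner_sq g v).mul_left (c ^ 2)
  have h3 : ‖u‖ ^ 2 ≤ (c * ‖v‖) ^ 2 := by
    rw [mul_pow]
    refine hasSum_le (fun i => ?_) h1 h2
    rw [← mul_pow]
    exact pow_le_pow_left₀ (norm_nonneg _) (h i) 2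
  exact le_of_sq_le_sq h3 (by positivity)

theorem ext_entries (g : HilbertBasis ι ℂ H) {X Y : H →L[ℂ] H}
    (h : ∀ i j, ⟪g i, X (g j)⟫_ℂ = ⟪g i, Y (g j)⟫_ℂ) : X = Y := by
  have h1 : ∀ j, X (g j) = Y (g j) := fun j => ext_inner_basis g fun i => h i j
  ext v
  have hv := g.hasSum_repr v
  have hX := X.hasSum hv
  have hY := Y.hasSum hv
  simp only [map_smul, h1] at hX hY
  exact hX.unique hY

theorem inner_basis (g : HilbertBasis ι ℂ H) [DecidableEq ι] (i j : ι) :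
    ⟪g i, g j⟫_ℂ = if i = j then 1 else 0 := by
  exact (orthonormal_iff_ite.mp g.orthonormal) i j

theorem hasSum_entry_mul (g : HilbertBasis ι ℂ H) (X : H →L[ℂ] H) (v : H) (i : ι) :
    HasSum (fun j => ⟪g i, X (g j)⟫_ℂ * ⟪g j, v⟫_ℂ) ⟪g i, X v⟫_ℂ := by
  have hX := (innerSL ℂ (g i)).hasSum (X.hasSum (g.hasSum_repr v))
  simp only [map_smul, innerSL_apply_apply, HilbertBasis.repr_apply_apply, smul_eq_mul] at hX
  simpa only [mul_comm] using hX

end HilbertBasisCoordinates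

/-! ### Hilbert-Schmidt operators and the contraction principle. -/

section HilbertSchmidtTheory

variable {ι : Type*} {H : Type*} [NormedAddCommGroup H] [InnerProductSpace ℂ H]
  {g : HilbertBasis ι ℂ H} {X Y : H →L[ℂ] H}

theorem isHilbertSchmidt_iff :
    IsHilbertSchmidt g X ↔ Summable fun j => ‖X (g j)‖ ^ 2 := by
  unfold IsHilbertSchmidt
  rw [summable_prod_of_nonneg (fun _ => by positivity)]
  have h : ∀ j, ∑' i, ‖⟪g i, X (g j)⟫_ℂ‖ ^ 2 = ‖X (g j)‖ ^ 2 := fun j =>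
    (hasSum_norm_inner_sq g _).tsum_eq
  simp only [h]
  exact ⟨fun h => h.2, fun h => ⟨fun j => (hasSum_norm_inner_sq g _).summable, h⟩⟩

theorem hsNorm_nonneg : 0 ≤ hsNorm g X := Real.sqrt_nonneg _

theorem hsNorm_sq : hsNorm g X ^ 2 = ∑' p : ι × ι, ‖⟪g p.2, X (g p.1)⟫_ℂ‖ ^ 2 :=
  Real.sq_sqrt (tsum_nonneg fun _ => by positivity)

theorem IsHilbertSchmidt.hasSum_entries (hX : IsHilbertSchmidt g X) :
    HasSum (fun p : ι × ι => ‖⟪g p.2, X (g p.1)⟫_ℂ‖ ^ 2) (hsNorm g X ^ 2) := by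
  rw [hsNorm_sq]; exact Summable.hasSum hX

theorem IsHilbertSchmidt.hasSum_columns (hX : IsHilbertSchmidt g X) :
    HasSum (fun j => ‖X (g j)‖ ^ 2) (hsNorm g X ^ 2) :=
  hX.hasSum_entries.prod_fiberwise fun j => hasSum_norm_inner_sq g (X (g j))

@[simp] theorem hsNorm_zero : hsNorm g (0 : H →L[ℂ] H) = 0 := by simp [hsNorm]

@[simp] theorem hsNorm_neg : hsNorm g (-X) = hsNorm g X := by simp [hsNorm]

theorem IsHilbertSchmidt.neg (hX : IsHilbertSchmidt g X) : IsHilbertSchmidt g (-X) := by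
  simpa [IsHilbertSchmidt] using hX

/-- If the finite partial sums of the squared entries are bounded by `C²`, the operator is
Hilbert-Schmidt with norm at most `C`. -/
theorem isHilbertSchmidt_of_sum_le {C : ℝ} (hC : 0 ≤ C)
    (h : ∀ F : Finset (ι × ι), ∑ p ∈ F, ‖⟪g p.2, X (g p.1)⟫_ℂ‖ ^ 2 ≤ C ^ 2) :
    IsHilbertSchmidt g X ∧ hsNorm g X ≤ C := by
  have hs : IsHilbertSchmidt g X := summable_of_sum_le (fun _ => by positivity) h
  exact ⟨hs, le_of_sq_le_sq (hasSum_le_of_sum_le hs.hasSum_entries h) hC⟩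

theorem IsHilbertSchmidt.sum_le (hX : IsHilbertSchmidt g X) (F : Finset (ι × ι)) :
    ∑ p ∈ F, ‖⟪g p.2, X (g p.1)⟫_ℂ‖ ^ 2 ≤ hsNorm g X ^ 2 :=
  sum_le_hasSum F (fun _ _ => by positivity) hX.hasSum_entries

theorem IsHilbertSchmidt.of_entry_le {c : ℝ} (hc : 0 ≤ c) (hX : IsHilbertSchmidt g X)
    (h : ∀ i j, ‖⟪g i, Y (g j)⟫_ℂ‖ ≤ c * ‖⟪g i, X (g j)⟫_ℂ‖) :
    IsHilbertSchmidt g Y ∧ hsNorm g Y ≤ c * hsNorm g X := by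
  refine isHilbertSchmidt_of_sum_le (mul_nonneg hc hsNorm_nonneg) fun F => ?_
  calc ∑ p ∈ F, ‖⟪g p.2, Y (g p.1)⟫_ℂ‖ ^ 2
      ≤ ∑ p ∈ F, c ^ 2 * ‖⟪g p.2, X (g p.1)⟫_ℂ‖ ^ 2 := by
        refine Finset.sum_le_sum fun p _ => ?_
        rw [← mul_pow]
        exact pow_le_pow_left₀ (norm_nonneg _) (h _ _) 2
    _ ≤ (c * hsNorm g X) ^ 2 := by
        rw [← Finset.mul_sum, mul_pow]
        exact mul_le_mul_of_nonneg_left (hX.sum_le F) (by positivity)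

theorem IsHilbertSchmidt.add (hX : IsHilbertSchmidt g X) (hY : IsHilbertSchmidt g Y) :
    IsHilbertSchmidt g (X + Y) ∧ hsNorm g (X + Y) ≤ hsNorm g X + hsNorm g Y := by
  refine isHilbertSchmidt_of_sum_le (add_nonneg hsNorm_nonneg hsNorm_nonneg) fun F => ?_
  have h2 : ∀ x : ℝ, x ^ (2 : ℝ) = x ^ 2 := fun x => Real.rpow_natCast x 2
  have h := Real.Lp_add_le_of_nonneg (s := F) (p := 2) (by norm_num)
    (f := fun p => ‖⟪g p.2, X (g p.1)⟫_ℂ‖) (g := fun p => ‖⟪g p.2, Y (g p.1)⟫_ℂ‖)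
    (fun _ _ => norm_nonneg _) (fun _ _ => norm_nonneg _)
  simp only [h2, ← Real.sqrt_eq_rpow] at h
  have hx : √(∑ p ∈ F, ‖⟪g p.2, X (g p.1)⟫_ℂ‖ ^ 2) ≤ hsNorm g X :=
    (Real.sqrt_le_left hsNorm_nonneg).mpr (hX.sum_le F)
  have hy : √(∑ p ∈ F, ‖⟪g p.2, Y (g p.1)⟫_ℂ‖ ^ 2) ≤ hsNorm g Y :=
    (Real.sqrt_le_left hsNorm_nonneg).mpr (hY.sum_le F)
  have h3 := (Real.sqrt_le_left (add_nonneg hsNorm_nonneg hsNorm_nonneg)).mp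
    (h.trans (add_le_add hx hy))
  refine le_trans (Finset.sum_le_sum fun p _ => ?_) h3
  refine pow_le_pow_left₀ (norm_nonneg _) ?_ 2
  rw [add_apply, inner_add_right]
  exact norm_add_le _ _

theorem IsHilbertSchmidt.sub (hX : IsHilbertSchmidt g X) (hY : IsHilbertSchmidt g Y) :
    IsHilbertSchmidt g (X - Y) ∧ hsNorm g (X - Y) ≤ hsNorm g X + hsNorm g Y := by
  have := hX.add hY.neg
  rwa [hsNorm_neg, ← sub_eq_add_neg] at this

variable [CompleteSpace H]

theorem adjoint_entry (i j : ι) :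
    ‖⟪g i, X.adjoint (g j)⟫_ℂ‖ = ‖⟪g j, X (g i)⟫_ℂ‖ := by
  rw [ContinuousLinearMap.adjoint_inner_right, norm_inner_symm]

theorem IsHilbertSchmidt.adjoint (hX : IsHilbertSchmidt g X) :
    IsHilbertSchmidt g X.adjoint ∧ hsNorm g X.adjoint = hsNorm g X := by
  constructor
  · have := (Equiv.prodComm ι ι).summable_iff.mpr hX
    refine this.congr fun p => ?_
    simp [adjoint_entry]
  · unfold hsNorm
    rw [← (Equiv.prodComm ι ι).tsum_eq]
    simp [adjoint_entry]

theorem IsHilbertSchmidt.hasSum_rows (hX : IsHilbertSchmidt g X) :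
    HasSum (fun i => ‖X.adjoint (g i)‖ ^ 2) (hsNorm g X ^ 2) := by
  rw [← hX.adjoint.2]
  exact hX.adjoint.1.hasSum_columns

/-- Cauchy-Schwarz row by row: the `i`-th coordinate of `X v` is `(v, X* g_i)`, and the squares of
the `‖X* g_i‖` sum to `‖X‖₂²`. -/
theorem IsHilbertSchmidt.norm_le (hX : IsHilbertSchmidt g X) : ‖X‖ ≤ hsNorm g X := by
  refine X.opNorm_le_bound hsNorm_nonneg fun v => ?_
  refine le_of_sq_le_sq ?_ (mul_nonneg hsNorm_nonneg (norm_nonneg _))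
  rw [mul_pow]
  refine hasSum_le (fun i => ?_) (hasSum_norm_inner_sq g (X v)) (hX.hasSum_rows.mul_right _)
  rw [← mul_pow, ← ContinuousLinearMap.adjoint_inner_left]
  exact pow_le_pow_left₀ (norm_nonneg _) (norm_inner_le_norm _ _) 2

theorem IsHilbertSchmidt.comp (hX : IsHilbertSchmidt g X) (hY : IsHilbertSchmidt g Y) :
    IsHilbertSchmidt g (X ∘L Y) ∧ hsNorm g (X ∘L Y) ≤ hsNorm g X * hsNorm g Y := by
  have h : ∀ j, ‖(X ∘L Y) (g j)‖ ^ 2 ≤ hsNorm g X ^ 2 * ‖Y (g j)‖ ^ 2 := fun j => by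
    rw [← mul_pow]
    refine pow_le_pow_left₀ (norm_nonneg _) ?_ 2
    exact (X.le_opNorm _).trans (mul_le_mul_of_nonneg_right hX.norm_le (norm_nonneg _))
  have hs : IsHilbertSchmidt g (X ∘L Y) :=
    isHilbertSchmidt_iff.mpr (Summable.of_nonneg_of_le (fun _ => by positivity) h
      (hY.hasSum_columns.summable.mul_left _))
  refine ⟨hs, le_of_sq_le_sq ?_ (mul_nonneg hsNorm_nonneg hsNorm_nonneg)⟩
  rw [mul_pow]
  exact hasSum_le h hs.hasSum_columns (hY.hasSum_columns.mul_left _)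

/-- Fatou's lemma for Hilbert-Schmidt norms. -/
theorem isHilbertSchmidt_of_tendsto {Z : ℕ → H →L[ℂ] H} {C : ℝ} (hC : 0 ≤ C)
    (hZ : ∀ᶠ n in Filter.atTop, IsHilbertSchmidt g (Z n) ∧ hsNorm g (Z n) ≤ C)
    (hX : Filter.Tendsto Z Filter.atTop (nhds X)) :
    IsHilbertSchmidt g X ∧ hsNorm g X ≤ C := by
  refine isHilbertSchmidt_of_sum_le hC fun F => ?_
  have ht : Filter.Tendsto (fun n => ∑ p ∈ F, ‖⟪g p.2, Z n (g p.1)⟫_ℂ‖ ^ 2) Filter.atTop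
      (nhds (∑ p ∈ F, ‖⟪g p.2, X (g p.1)⟫_ℂ‖ ^ 2)) := by
    refine tendsto_finsetSum _ fun p _ => ?_
    have hc : Continuous fun T : H →L[ℂ] H => ‖⟪g p.2, T (g p.1)⟫_ℂ‖ ^ 2 := by fun_prop
    exact (hc.tendsto X).comp hX
  refine le_of_tendsto ht ?_
  filter_upwards [hZ] with n hn
  exact (hn.1.sum_le F).trans (pow_le_pow_left₀ hsNorm_nonneg hn.2 2)

/-- The contraction principle in a ball of Hilbert-Schmidt operators. -/
theorem existsUnique_fixedPoint {Φ : (H →L[ℂ] H) → H →L[ℂ] H} {B : H →L[ℂ] H} {r q : ℝ}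
    (hB : IsHilbertSchmidt g B) (hr : 0 ≤ r) (hq₀ : 0 ≤ q) (hq : q < 1)
    (hmaps : ∀ X, IsHilbertSchmidt g X → hsNorm g (X - B) ≤ r →
      IsHilbertSchmidt g (Φ X) ∧ hsNorm g (Φ X - B) ≤ r)
    (hlip : ∀ X Y, IsHilbertSchmidt g X → hsNorm g (X - B) ≤ r → IsHilbertSchmidt g Y →
      hsNorm g (Y - B) ≤ r → hsNorm g (Φ X - Φ Y) ≤ q * hsNorm g (X - Y)) :
    ∃! X, IsHilbertSchmidt g X ∧ hsNorm g (X - B) ≤ r ∧ X = Φ X := by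
  have hzero : ∀ X Y : H →L[ℂ] H, IsHilbertSchmidt g X → IsHilbertSchmidt g Y →
      hsNorm g (X - Y) ≤ 0 → X = Y := fun X Y hX hY h => by
    have := (hX.sub hY).1.norm_le.trans h
    rwa [norm_le_zero_iff, sub_eq_zero] at this
  -- Picard iteration from the centre of the ball. The limit is taken in the operator norm, which
  -- the Hilbert-Schmidt norm dominates; Fatou's lemma then returns the Hilbert-Schmidt bounds to
  -- the limit.
  set Z : ℕ → H →L[ℂ] H := fun n => Φ^[n] B with hZdef
  have hZs : ∀ n, Z (n + 1) = Φ (Z n) := fun n => Function.iterate_succ_apply' Φ n B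
  have hZ : ∀ n, IsHilbertSchmidt g (Z n) ∧ hsNorm g (Z n - B) ≤ r := by
    intro n
    induction n with
    | zero => exact ⟨hB, by simpa [hZdef] using hr⟩
    | succ n ih => rw [hZs]; exact hmaps _ ih.1 ih.2
  set c := hsNorm g (Z 1 - Z 0)
  have hstep : ∀ n, hsNorm g (Z (n + 1) - Z n) ≤ c * q ^ n := by
    intro n
    induction n with
    | zero => simp [c]
    | succ n ih =>
      rw [hZs (n + 1), hZs n]
      refine (hlip _ _ (hmaps _ (hZ n).1 (hZ n).2).1 (hmaps _ (hZ n).1 (hZ n).2).2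
        (hZ n).1 (hZ n).2).trans ?_
      rw [← hZs n, pow_succ]
      calc q * hsNorm g (Z (n + 1) - Z n) ≤ q * (c * q ^ n) := mul_le_mul_of_nonneg_left ih hq₀
        _ = c * (q ^ n * q) := by ring
  have hcauchy : CauchySeq Z := by
    refine cauchySeq_of_le_geometric q c hq fun n => ?_
    rw [dist_comm, dist_eq_norm]
    exact ((hZ (n + 1)).1.sub (hZ n).1).1.norm_le.trans (hstep n)
  obtain ⟨X, hX⟩ := cauchySeq_tendsto_of_complete hcauchy
  have htail : ∀ n p, hsNorm g (Z (n + p) - Z n) ≤ c / (1 - q) * q ^ n := by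
    intro n p
    have h1q : 0 < 1 - q := by linarith
    -- The exact partial sum of the geometric series; without the factor `1 - q ^ p` the induction
    -- does not close.
    have : hsNorm g (Z (n + p) - Z n) ≤ c / (1 - q) * q ^ n * (1 - q ^ p) := by
      induction p with
      | zero => simp
      | succ p ih =>
        have h1 := ((hZ (n + p + 1)).1.sub (hZ (n + p)).1).1.add
          ((hZ (n + p)).1.sub (hZ n).1).1
        rw [sub_add_sub_cancel] at h1
        refine h1.2.trans ((add_le_add (hstep (n + p)) ih).trans (le_of_eq ?_))
        field_simp
        ring
    refine this.trans (mul_le_of_le_one_right ?_ ?_)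
    · have : 0 ≤ c := hsNorm_nonneg
      positivity
    · linarith [pow_nonneg hq₀ p]
  have hball : IsHilbertSchmidt g (X - B) ∧ hsNorm g (X - B) ≤ r :=
    isHilbertSchmidt_of_tendsto hr (Filter.Eventually.of_forall fun n =>
      ⟨((hZ n).1.sub hB).1, (hZ n).2⟩) (hX.sub_const B)
  have hXHS : IsHilbertSchmidt g X := by
    have := (hball.1.add hB).1
    rwa [sub_add_cancel] at this
  have hconv : ∀ n, hsNorm g (X - Z n) ≤ c / (1 - q) * q ^ n := fun n => by
    have h1q : 0 < 1 - q := by linarith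
    have : 0 ≤ c := hsNorm_nonneg
    refine (isHilbertSchmidt_of_tendsto (Z := fun p => Z (n + p) - Z n) (by positivity)
      (Filter.Eventually.of_forall fun p => ⟨((hZ _).1.sub (hZ n).1).1, htail n p⟩) ?_).2
    have := (Filter.tendsto_add_atTop_iff_nat n).mpr hX
    simp only [add_comm _ n] at this
    exact this.sub_const _
  have hΦ := hmaps X hXHS hball.2
  have hfix : X = Φ X := by
    refine hzero _ _ hXHS hΦ.1 ?_
    -- Pass through `Z (n + 1) = Φ (Z n)`: one factor `q` comes from the tail bound at `n + 1`, the
    -- other from the Lipschitz bound applied to `Z n` and `X`.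
    have hle : ∀ n, hsNorm g (X - Φ X) ≤ c / (1 - q) * q ^ n * (2 * q) := fun n => by
      have h1 := (hXHS.sub (hZ (n + 1)).1).1.add ((hZ (n + 1)).1.sub hΦ.1).1
      rw [sub_add_sub_cancel] at h1
      refine h1.2.trans ?_
      have h2 := hlip _ _ (hZ n).1 (hZ n).2 hXHS hball.2
      rw [← hZs, ← hsNorm_neg (X := Z n - X), neg_sub] at h2
      have h3 := mul_le_mul_of_nonneg_left (hconv n) hq₀
      have h4 := hconv (n + 1)
      rw [pow_succ] at h4
      linarith
    have ht : Filter.Tendsto (fun n : ℕ => c / (1 - q) * q ^ n * (2 * q)) Filter.atTop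
        (nhds (c / (1 - q) * 0 * (2 * q))) :=
      ((tendsto_pow_atTop_nhds_zero_of_lt_one hq₀ hq).const_mul _).mul_const _
    simpa using ge_of_tendsto' ht hle
  refine ⟨X, ⟨hXHS, hball.2, hfix⟩, ?_⟩
  rintro Y ⟨hY, hYB, hYΦ⟩
  refine hzero _ _ hY hXHS ?_
  have := hlip _ _ hY hYB hXHS hball.2
  rw [← hYΦ, ← hfix] at this
  have h0 : 0 ≤ hsNorm g (Y - X) := hsNorm_nonneg
  nlinarith

/-- A family of operators whose matrices are carried by disjoint sets of positions and are
entrywise dominated by a Hilbert-Schmidt matrix is summable in the operator norm. -/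
theorem IsHilbertSchmidt.summable_of_disjoint {S : Type*} [DecidableEq S] {Y : S → H →L[ℂ] H}
    {c : ℝ} (hX : IsHilbertSchmidt g X) (q : ι → ι → S)
    (hY : ∀ s i j, ‖⟪g i, Y s (g j)⟫_ℂ‖ ≤ if q i j = s then c * ‖⟪g i, X (g j)⟫_ℂ‖ else 0) :
    Summable Y := by
  rw [summable_iff_vanishing_norm]
  intro ε hε
  have hs : Summable fun p : ι × ι => c ^ 2 * ‖⟪g p.2, X (g p.1)⟫_ℂ‖ ^ 2 := Summable.mul_left _ hX
  rw [summable_iff_vanishing_norm] at hs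
  obtain ⟨F, hF⟩ := hs ((ε / 2) ^ 2) (by positivity)
  -- Outside `F` the squared entries have small sum. A set `T` that avoids the labels of the
  -- positions in `F` yields a partial sum carried by positions outside `F`.
  refine ⟨F.image fun p => q p.2 p.1, fun T hT => ?_⟩
  refine lt_of_le_of_lt ?_ (half_lt_self hε)
  have key : ∀ i j, ‖⟪g i, (∑ s ∈ T, Y s) (g j)⟫_ℂ‖ ≤
      if q i j ∈ T then c * ‖⟪g i, X (g j)⟫_ℂ‖ else 0 := fun i j => by
    rw [sum_apply, inner_sum]
    refine (norm_sum_le _ _).trans ((Finset.sum_le_sum fun s _ => hY s i j).trans ?_)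
    rw [Finset.sum_ite_eq]
  have h := isHilbertSchmidt_of_sum_le (g := g) (X := ∑ s ∈ T, Y s) (half_pos hε).le fun G => ?_
  · exact h.1.norm_le.trans h.2
  classical
  calc ∑ p ∈ G, ‖⟪g p.2, (∑ s ∈ T, Y s) (g p.1)⟫_ℂ‖ ^ 2
      ≤ ∑ p ∈ G, if q p.2 p.1 ∈ T then c ^ 2 * ‖⟪g p.2, X (g p.1)⟫_ℂ‖ ^ 2 else 0 := by
        refine Finset.sum_le_sum fun p _ => ?_
        have h1 := pow_le_pow_left₀ (norm_nonneg _) (key p.2 p.1) 2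
        split_ifs at h1 ⊢
        · rwa [mul_pow] at h1
        · simpa using h1
    _ = ∑ p ∈ G with q p.2 p.1 ∈ T, c ^ 2 * ‖⟪g p.2, X (g p.1)⟫_ℂ‖ ^ 2 :=
        (Finset.sum_filter _ _).symm
    _ ≤ (ε / 2) ^ 2 := by
        refine (Real.le_norm_self _).trans (hF _ ?_).le
        rw [Finset.disjoint_left]
        intro p hp hpF
        exact Finset.disjoint_left.mp hT (Finset.mem_filter.mp hp).2
          (Finset.mem_image_of_mem _ hpF)

omit [CompleteSpace H] in
theorem hasSum_entry_tsum {S : Type*} {Y : S → H →L[ℂ] H} (hY : Summable Y) (u v : H) :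
    HasSum (fun s => ⟪u, Y s v⟫_ℂ) ⟪u, (∑' s, Y s) v⟫_ℂ :=
  (innerSL ℂ u).hasSum ((ContinuousLinearMap.apply ℂ H v).hasSum hY.hasSum)

end HilbertSchmidtTheory

/-! ### Indices and eigenvalues -/

/-- The index `n ≥ 0` of the eigenspace of the unperturbed operator that contains `e_j`. -/
def cls (θ : ℕ) (j : ℤ) : ℕ := if 0 ≤ j then j.toNat else (-j - θ).toNat

/-- The index of the block that contains `e_j` when the first `m + 1` eigenspaces are merged. -/
def blk (θ m : ℕ) (j : ℤ) : ℕ := max (cls θ j) m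

section Eigenvalues

variable {ω : ℝ} {k θ : ℕ}

theorem cls_eq_iff (hθ : θ = 0 ∨ θ = 1) (j : ℤ) (n : ℕ) :
    cls θ j = n ↔ j = -(n : ℤ) - θ ∨ j = n := by
  unfold cls; split_ifs <;> omega

theorem lam_cls (hθ : θ = 0 ∨ θ = 1) (j : ℤ) : lam ω k θ (cls θ j : ℤ) = lam ω k θ j := by
  rcases (cls_eq_iff hθ j (cls θ j)).mp rfl with h | h
  · have h2 : (2 * ((cls θ j : ℤ) : ℝ) + θ) = -(2 * (j : ℝ) + θ) := by
      have : (j : ℝ) = -((cls θ j : ℤ) : ℝ) - θ := by exact_mod_cast h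
      rw [this]; ring
    unfold lam
    rw [h2, Even.neg_pow (even_two_mul k)]
  · rw [← h]

theorem lam_eq (j : ℤ) :
    lam ω k θ j = Real.pi ^ (2 * k) / ω ^ (2 * k) * (2 * (j : ℝ) + θ) ^ (2 * k) := by
  unfold lam; ring

theorem lam_nonneg (hω : 0 < ω) (j : ℤ) : 0 ≤ lam ω k θ j := by
  rw [lam_eq]
  have : 0 ≤ (2 * (j : ℝ) + θ) ^ (2 * k) := (even_two_mul k).pow_nonneg _
  positivity

/-- The local gap at `λ_n`, needed for the decay of `C_n`. With `a = 2n + θ` and `b = 2p + θ`, the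
difference of the `2k`-th powers is at least `a^(2k-2) (a² - b²)`, and `a² - b² ≥ 4n`. -/
theorem lam_sub_lam_ge (hω : 0 < ω) (hk : 1 < k) {n p : ℕ} (h : p < n) :
    Real.pi ^ (2 * k) / ω ^ (2 * k) * (4 * n * (2 * (n : ℝ) + θ) ^ (2 * k - 2)) ≤
      lam ω k θ n - lam ω k θ p := by
  rw [lam_eq, lam_eq, ← mul_sub]
  refine mul_le_mul_of_nonneg_left ?_ (by positivity)
  push_cast
  obtain ⟨l, rfl⟩ : ∃ l, k = l + 1 := ⟨k - 1, by omega⟩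
  have hn : (p : ℝ) + 1 ≤ n := by exact_mod_cast h
  set a : ℝ := 2 * (n : ℝ) + θ with ha
  set b : ℝ := 2 * (p : ℝ) + θ with hb
  have hb0 : 0 ≤ b := by positivity
  have hab : b + 2 ≤ a := by linarith
  have hθ0 : (0 : ℝ) ≤ θ := by positivity
  have hp0 : (0 : ℝ) ≤ p := by positivity
  rw [show 2 * (l + 1) - 2 = 2 * l by omega, show 2 * (l + 1) = 2 * l + 2 by ring, pow_add, pow_add]
  have h1 : b ^ (2 * l) ≤ a ^ (2 * l) := pow_le_pow_left₀ hb0 (by linarith) _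
  have h2 : 4 * (n : ℝ) ≤ a ^ 2 - b ^ 2 := by nlinarith
  have h3 : 0 ≤ a ^ (2 * l) := by positivity
  nlinarith [mul_le_mul_of_nonneg_left h2 h3, mul_le_mul_of_nonneg_right h1 (sq_nonneg b)]

/-- The gap between blocks. Since `λ_p ≤ λ_m` for `p ≤ m`, the lower index may be taken at least
`m`. There `a⁴ - b⁴ = (a² - b²)(a² + b²)` is at least `4 (2m + 1) · 2 b²`; splitting off a fourth
power is where `k ≥ 2` enters. -/
theorem lam_sub_lam_ge' (hω : 0 < ω) (hk : 1 < k) {m n p : ℕ} (h : p < n) (hmn : m < n) :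
    Real.pi ^ (2 * k) / ω ^ (2 * k) * (8 * (2 * m + 1) * (2 * (m : ℝ) + θ) ^ (2 * k - 2)) ≤
      lam ω k θ n - lam ω k θ p := by
  rw [lam_eq, lam_eq, ← mul_sub]
  refine mul_le_mul_of_nonneg_left ?_ (by positivity)
  push_cast
  obtain ⟨l, rfl⟩ : ∃ l, k = l + 2 := ⟨k - 2, by omega⟩
  have hθ0 : (0 : ℝ) ≤ θ := by positivity
  have main : ∀ s : ℕ, s < n → m ≤ s →
      8 * (2 * m + 1) * (2 * (m : ℝ) + θ) ^ (2 * (l + 2) - 2) ≤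
        (2 * (n : ℝ) + θ) ^ (2 * (l + 2)) - (2 * (s : ℝ) + θ) ^ (2 * (l + 2)) := by
    intro s hs hms
    have hn : (s : ℝ) + 1 ≤ n := by exact_mod_cast hs
    have hms' : (m : ℝ) ≤ s := by exact_mod_cast hms
    have hm0 : (0 : ℝ) ≤ m := by positivity
    set a : ℝ := 2 * (n : ℝ) + θ with ha
    set b : ℝ := 2 * (s : ℝ) + θ with hb
    have hb0 : 0 ≤ b := by positivity
    have hab : b + 2 ≤ a := by linarith
    have hc : (2 * (m : ℝ) + θ) ^ (2 * l + 2) ≤ b ^ (2 * l + 2) :=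
      pow_le_pow_left₀ (by positivity) (by linarith) _
    rw [show 2 * (l + 2) - 2 = 2 * l + 2 by omega, show 2 * (l + 2) = 2 * l + 4 by ring]
    have h1 : b ^ (2 * l) ≤ a ^ (2 * l) := pow_le_pow_left₀ hb0 (by linarith) _
    have h2 : 4 * (2 * (m : ℝ) + 1) ≤ a ^ 2 - b ^ 2 := by nlinarith
    have h3 : 8 * (2 * (m : ℝ) + 1) * b ^ 2 ≤ a ^ 4 - b ^ 4 := by
      have : 2 * b ^ 2 ≤ a ^ 2 + b ^ 2 := by nlinarith
      nlinarith [mul_le_mul h2 this (by positivity) (by nlinarith)]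
    calc 8 * (2 * (m : ℝ) + 1) * (2 * (m : ℝ) + θ) ^ (2 * l + 2)
        ≤ 8 * (2 * (m : ℝ) + 1) * b ^ (2 * l + 2) :=
          mul_le_mul_of_nonneg_left hc (by positivity)
      _ = b ^ (2 * l) * (8 * (2 * (m : ℝ) + 1) * b ^ 2) := by ring
      _ ≤ b ^ (2 * l) * (a ^ 4 - b ^ 4) := mul_le_mul_of_nonneg_left h3 (by positivity)
      _ = b ^ (2 * l) * a ^ 4 - b ^ (2 * l + 4) := by ring
      _ ≤ a ^ (2 * l + 4) - b ^ (2 * l + 4) := by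
          rw [pow_add a]
          have : 0 ≤ a ^ 4 := by positivity
          nlinarith [mul_le_mul_of_nonneg_right h1 this]
  rcases le_total m p with hmp | hmp
  · exact main p h hmp
  · refine (main m hmn le_rfl).trans ?_
    have hp' : (p : ℝ) ≤ m := by exact_mod_cast hmp
    have : (2 * (p : ℝ) + θ) ^ (2 * (l + 2)) ≤ (2 * (m : ℝ) + θ) ^ (2 * (l + 2)) :=
      pow_le_pow_left₀ (by positivity) (by linarith) _
    linarith

theorem lam_natCast_inj (hω : 0 < ω) (hk : 1 < k) {n p : ℕ} :
    lam ω k θ n = lam ω k θ p ↔ n = p := by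
  have key : ∀ {n p : ℕ}, p < n → lam ω k θ p < lam ω k θ n := fun {n p} h => by
    have h1 := lam_sub_lam_ge (θ := θ) hω hk h
    have hn : (0 : ℝ) < n := by exact_mod_cast (by omega : 0 < n)
    have : 0 < Real.pi ^ (2 * k) / ω ^ (2 * k) * (4 * n * (2 * (n : ℝ) + θ) ^ (2 * k - 2)) := by
      positivity
    linarith
  refine ⟨fun h => ?_, fun h => by rw [h]⟩
  rcases lt_trichotomy n p with hlt | rfl | hlt
  · exact absurd h (key hlt).ne
  · rfl
  · exact absurd h (key hlt).ne'

theorem lam_eq_lam_iff (hω : 0 < ω) (hk : 1 < k) (hθ : θ = 0 ∨ θ = 1) {i j : ℤ} :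
    lam ω k θ i = lam ω k θ j ↔ cls θ i = cls θ j := by
  rw [← lam_cls hθ i, ← lam_cls hθ j, lam_natCast_inj hω hk]

theorem abs_lam_sub_lam_ge (hω : 0 < ω) (hk : 1 < k) (hθ : θ = 0 ∨ θ = 1) {i j : ℤ}
    (h : cls θ i ≠ cls θ j) :
    Real.pi ^ (2 * k) / ω ^ (2 * k) * (4 * cls θ j * (2 * (cls θ j : ℝ) + θ) ^ (2 * k - 2)) ≤
      |lam ω k θ i - lam ω k θ j| := by
  rw [← lam_cls hθ i, ← lam_cls hθ j]
  rcases lt_or_gt_of_ne h with h | h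
  · rw [abs_sub_comm]
    exact (lam_sub_lam_ge hω hk h).trans (le_abs_self _)
  · refine le_trans ?_ ((lam_sub_lam_ge hω hk h).trans (le_abs_self _))
    have : (cls θ j : ℝ) ≤ cls θ i := by exact_mod_cast h.le
    gcongr

theorem abs_lam_sub_lam_ge' (hω : 0 < ω) (hk : 1 < k) (hθ : θ = 0 ∨ θ = 1) {m : ℕ} {i j : ℤ}
    (h : blk θ m i ≠ blk θ m j) :
    Real.pi ^ (2 * k) / ω ^ (2 * k) * (8 * (2 * m + 1) * (2 * (m : ℝ) + θ) ^ (2 * k - 2)) ≤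
      |lam ω k θ i - lam ω k θ j| := by
  unfold blk at h
  rw [← lam_cls hθ i, ← lam_cls hθ j]
  rcases lt_trichotomy (cls θ i) (cls θ j) with h' | h' | h'
  · rw [abs_sub_comm]
    exact (lam_sub_lam_ge' hω hk h' (by omega)).trans (le_abs_self _)
  · exact absurd (by rw [h']) h
  · exact (lam_sub_lam_ge' hω hk h' (by omega)).trans (le_abs_self _)

/-- A crude gap, uniform over all pairs of eigenspaces. It bounds the coefficients of the series for
`Γ`, so that the series converges. -/
theorem abs_lam_sub_lam_ge_const (hω : 0 < ω) (hk : 1 < k) (hθ : θ = 0 ∨ θ = 1) {i j : ℤ}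
    (h : cls θ i ≠ cls θ j) :
    Real.pi ^ (2 * k) / ω ^ (2 * k) ≤ |lam ω k θ i - lam ω k θ j| := by
  have key : ∀ n p : ℕ, p < n →
      Real.pi ^ (2 * k) / ω ^ (2 * k) ≤ lam ω k θ n - lam ω k θ p := fun n p hlt => by
    refine le_trans ?_ (lam_sub_lam_ge hω hk hlt)
    refine le_mul_of_one_le_right (by positivity) ?_
    have hn : (1 : ℝ) ≤ n := by exact_mod_cast (by omega : 1 ≤ n)
    have h1 : (1 : ℝ) ≤ (2 * (n : ℝ) + θ) ^ (2 * k - 2) :=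
      one_le_pow₀ (by have : (0 : ℝ) ≤ θ := by positivity
                      linarith)
    nlinarith
  rw [← lam_cls hθ i, ← lam_cls hθ j]
  rcases lt_or_gt_of_ne h with h' | h'
  · rw [abs_sub_comm]
    exact (key _ _ h').trans (le_abs_self _)
  · exact (key _ _ h').trans (le_abs_self _)

theorem summable_inv_lam_add (hω : 0 < ω) (hk : 1 < k) (hθ : θ = 0 ∨ θ = 1) {M : ℝ}
    (hM : 0 < M) : Summable fun j : ℤ => (lam ω k θ j + M)⁻¹ := by
  have hs := (Real.summable_one_div_int_pow (p := 2)).mpr (by norm_num)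
  have hs2 := hs.mul_left (Real.pi ^ (2 * k) / ω ^ (2 * k))⁻¹
  refine Summable.of_norm_bounded_eventually hs2 ?_
  -- At `j = 0` the comparison term `1 / j ^ 2` takes the value `0`, so this index has to be set
  -- aside.
  have hfin : ∀ᶠ j : ℤ in Filter.cofinite, j ≠ 0 :=
    (Set.finite_singleton (0 : ℤ)).compl_mem_cofinite
  filter_upwards [hfin] with j hj
  have h0 := lam_nonneg (k := k) (θ := θ) hω j
  rw [Real.norm_of_nonneg (by positivity), one_div, ← mul_inv]
  have hj2 : (0 : ℝ) < (j : ℝ) ^ 2 := by positivity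
  refine inv_anti₀ (by positivity) ?_
  rw [lam_eq]
  have h1 : (j : ℝ) ^ 2 ≤ (2 * (j : ℝ) + θ) ^ (2 * k) := by
    have h2 : j ^ 2 ≤ (2 * j + θ) ^ 2 := by
      rcases hθ with rfl | rfl
      · push_cast; nlinarith
      · push_cast
        rcases lt_or_gt_of_ne hj with h | h <;> nlinarith
    have h3 : (2 * j + θ) ^ 2 ≤ (2 * j + (θ : ℤ)) ^ (2 * k) := by
      rw [pow_mul]
      refine le_self_pow₀ ?_ (by omega)
      have : 0 < j ^ 2 := by positivity
      omega
    exact_mod_cast h2.trans h3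
  have := mul_le_mul_of_nonneg_left h1
    (by positivity : 0 ≤ Real.pi ^ (2 * k) / ω ^ (2 * k))
  linarith

end Eigenvalues

/-! ### Matrix entries of the projections and the transformers -/

section Entries

variable {H : Type*} [NormedAddCommGroup H] [InnerProductSpace ℂ H]
  {θ : ℕ} {e : HilbertBasis ℤ ℂ H}

theorem inner_projN (hθ : θ = 0 ∨ θ = 1) (n : ℕ) (i : ℤ) (v : H) :
    ⟪e i, projN θ e n v⟫_ℂ = if cls θ i = n then ⟪e i, v⟫_ℂ else 0 := by
  unfold projN
  rw [sum_apply, inner_sum]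
  simp only [InnerProductSpace.rankOne_apply, inner_smul_right, inner_basis, mul_ite, mul_one,
    mul_zero, Finset.sum_ite_eq, cls_eq_iff hθ]
  simp

theorem inner_projUpTo (hθ : θ = 0 ∨ θ = 1) (m : ℕ) (i : ℤ) (v : H) :
    ⟪e i, projUpTo θ e m v⟫_ℂ = if cls θ i ≤ m then ⟪e i, v⟫_ℂ else 0 := by
  unfold projUpTo
  rw [sum_apply, inner_sum]
  simp only [inner_projN hθ, Finset.sum_ite_eq, Finset.mem_range, Nat.lt_succ_iff]

theorem projN_basis (hθ : θ = 0 ∨ θ = 1) (n : ℕ) (j : ℤ) :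
    projN θ e n (e j) = if cls θ j = n then e j else 0 := by
  refine ext_inner_basis e fun i => ?_
  rw [inner_projN hθ]
  by_cases hij : i = j
  · subst hij; split_ifs <;> simp
  · split_ifs <;> simp [inner_basis, hij]

theorem projUpTo_basis (hθ : θ = 0 ∨ θ = 1) (m : ℕ) (j : ℤ) :
    projUpTo θ e m (e j) = if cls θ j ≤ m then e j else 0 := by
  refine ext_inner_basis e fun i => ?_
  rw [inner_projUpTo hθ]
  by_cases hij : i = j
  · subst hij; split_ifs <;> simp
  · split_ifs <;> simp [inner_basis, hij]

theorem entry_projN_comp (hθ : θ = 0 ∨ θ = 1) (n p : ℕ) (X : H →L[ℂ] H) (i j : ℤ) :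
    ⟪e i, (projN θ e n ∘L X ∘L projN θ e p) (e j)⟫_ℂ =
      if cls θ i = n ∧ cls θ j = p then ⟪e i, X (e j)⟫_ℂ else 0 := by
  simp only [ContinuousLinearMap.comp_apply, inner_projN hθ, projN_basis hθ]
  split_ifs <;> simp_all

theorem entry_projUpTo_comp (hθ : θ = 0 ∨ θ = 1) (m : ℕ) (X : H →L[ℂ] H) (i j : ℤ) :
    ⟪e i, (projUpTo θ e m ∘L X ∘L projUpTo θ e m) (e j)⟫_ℂ =
      if cls θ i ≤ m ∧ cls θ j ≤ m then ⟪e i, X (e j)⟫_ℂ else 0 := by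
  simp only [ContinuousLinearMap.comp_apply, inner_projUpTo hθ, projUpTo_basis hθ]
  split_ifs <;> simp_all

theorem entry_sub_projUpTo (hθ : θ = 0 ∨ θ = 1) (m : ℕ) (X : H →L[ℂ] H) (i j : ℤ) :
    ⟪e i, (X - projUpTo θ e m ∘L X ∘L projUpTo θ e m) (e j)⟫_ℂ =
      if cls θ i ≤ m ∧ cls θ j ≤ m then 0 else ⟪e i, X (e j)⟫_ℂ := by
  rw [sub_apply, inner_sub_right, entry_projUpTo_comp hθ]
  split_ifs <;> simp

variable [CompleteSpace H] {ω : ℝ} {k : ℕ} {X : H →L[ℂ] H}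

/-- The terms of the series occupy disjoint positions and are dominated by the entries of `X`, so
the series does converge in the operator norm and its entries can be summed termwise. -/
theorem entry_transJ (hθ : θ = 0 ∨ θ = 1) (hX : IsHilbertSchmidt e X) (i j : ℤ) :
    ⟪e i, transJ θ e X (e j)⟫_ℂ = if cls θ i = cls θ j then ⟪e i, X (e j)⟫_ℂ else 0 := by
  have hs : Summable fun n : ℕ => projN θ e n ∘L X ∘L projN θ e n := by
    refine hX.summable_of_disjoint (c := 1) (fun i _ => cls θ i) fun n i j => ?_
    rw [entry_projN_comp hθ]
    split_ifs <;> simp_all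
  refine (hasSum_entry_tsum hs (e i) (e j)).unique ?_
  simp only [entry_projN_comp hθ]
  split_ifs with h
  · convert hasSum_ite_eq (cls θ i) ⟪e i, X (e j)⟫_ℂ using 2 with n
    simp [← h, eq_comm]
  · convert hasSum_zero with n
    split_ifs <;> simp_all

theorem entry_transΓ (hω : 0 < ω) (hk : 1 < k) (hθ : θ = 0 ∨ θ = 1) (hX : IsHilbertSchmidt e X)
    (i j : ℤ) :
    ⟪e i, transΓ ω k θ e X (e j)⟫_ℂ = if cls θ i = cls θ j then 0 else
      ((lam ω k θ i - lam ω k θ j : ℝ) : ℂ)⁻¹ * ⟪e i, X (e j)⟫_ℂ := by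
  classical
  have hterm : ∀ (p : ℕ × ℕ) (i j : ℤ),
      ⟪e i, (if lam ω k θ p.1 ≠ lam ω k θ p.2 then
        (((lam ω k θ p.1 - lam ω k θ p.2)⁻¹ : ℝ) : ℂ) •
          (projN θ e p.1 ∘L X ∘L projN θ e p.2) else 0 : H →L[ℂ] H) (e j)⟫_ℂ =
      if p = (cls θ i, cls θ j) then (if cls θ i = cls θ j then 0 else
        ((lam ω k θ i - lam ω k θ j : ℝ) : ℂ)⁻¹ * ⟪e i, X (e j)⟫_ℂ) else 0 := by
    rintro ⟨n, p⟩ i j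
    simp only [ne_eq, lam_natCast_inj hω hk, Prod.mk.injEq]
    by_cases hnp : n = p
    · subst hnp
      simp only [not_true_eq_false, if_false, zero_apply, inner_zero_right]
      split_ifs with h1 h2
      · rfl
      · exact absurd (h1.1.symm.trans h1.2) h2
      · rfl
    · rw [if_pos hnp, smul_apply, inner_smul_right, entry_projN_comp hθ]
      by_cases h : cls θ i = n ∧ cls θ j = p
      · obtain ⟨rfl, rfl⟩ := h
        rw [if_pos ⟨rfl, rfl⟩, if_pos ⟨rfl, rfl⟩, if_neg hnp, lam_cls hθ, lam_cls hθ,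
          Complex.ofReal_inv]
      · rw [if_neg h, if_neg (by tauto), mul_zero]
  have hs : Summable fun p : ℕ × ℕ => (if lam ω k θ p.1 ≠ lam ω k θ p.2 then
      (((lam ω k θ p.1 - lam ω k θ p.2)⁻¹ : ℝ) : ℂ) • (projN θ e p.1 ∘L X ∘L projN θ e p.2)
        else 0 : H →L[ℂ] H) := by
    refine hX.summable_of_disjoint (c := (Real.pi ^ (2 * k) / ω ^ (2 * k))⁻¹)
      (fun i j => (cls θ i, cls θ j)) fun p i j => ?_
    rw [hterm]
    by_cases hp : p = (cls θ i, cls θ j)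
    · rw [if_pos hp, if_pos hp.symm]
      split_ifs with h
      · rw [norm_zero]; positivity
      · rw [norm_mul, norm_inv, Complex.norm_real]
        refine mul_le_mul_of_nonneg_right (inv_anti₀ (by positivity) ?_) (norm_nonneg _)
        exact abs_lam_sub_lam_ge_const hω hk hθ h
    · rw [if_neg hp, if_neg (Ne.symm hp), norm_zero]
  refine (hasSum_entry_tsum hs (e i) (e j)).unique ?_
  simp only [hterm]
  exact hasSum_ite_eq _ _

variable (m : ℕ)

omit [CompleteSpace H] in
theorem isHilbertSchmidt_sub_projUpTo (hθ : θ = 0 ∨ θ = 1) (hX : IsHilbertSchmidt e X) :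
    IsHilbertSchmidt e (X - projUpTo θ e m ∘L X ∘L projUpTo θ e m) := by
  refine (hX.of_entry_le zero_le_one fun i j => ?_).1
  rw [entry_sub_projUpTo hθ]
  split_ifs <;> simp

/-- Together with `entry_transΓm` this replaces the series by entrywise multipliers adapted to the
partition `blk`; later arguments about `J_m` and `Γ_m` rest on these two formulas. -/
theorem entry_transJm (hθ : θ = 0 ∨ θ = 1) (hX : IsHilbertSchmidt e X) (i j : ℤ) :
    ⟪e i, transJm θ e m X (e j)⟫_ℂ =
      if blk θ m i = blk θ m j then ⟪e i, X (e j)⟫_ℂ else 0 := by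
  unfold transJm
  rw [add_apply, inner_add_right,
    entry_transJ hθ (isHilbertSchmidt_sub_projUpTo m hθ hX), entry_sub_projUpTo hθ,
    entry_projUpTo_comp hθ]
  unfold blk
  by_cases h : cls θ i ≤ m ∧ cls θ j ≤ m
  · rw [if_pos h, if_pos h, if_pos (c := max _ _ = max _ _) (by omega)]; simp
  · rw [if_neg h, if_neg h, add_zero]
    refine if_congr ?_ rfl rfl
    omega

theorem entry_transΓm (hω : 0 < ω) (hk : 1 < k) (hθ : θ = 0 ∨ θ = 1) (hX : IsHilbertSchmidt e X)
    (i j : ℤ) :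
    ⟪e i, transΓm ω k θ e m X (e j)⟫_ℂ = if blk θ m i = blk θ m j then 0 else
      ((lam ω k θ i - lam ω k θ j : ℝ) : ℂ)⁻¹ * ⟪e i, X (e j)⟫_ℂ := by
  unfold transΓm
  rw [entry_transΓ hω hk hθ (isHilbertSchmidt_sub_projUpTo m hθ hX), entry_sub_projUpTo hθ]
  unfold blk
  by_cases h : cls θ i ≤ m ∧ cls θ j ≤ m
  · rw [if_pos h, if_pos (c := max _ _ = max _ _) (by omega)]; simp
  · rw [if_neg h]
    refine if_congr ?_ rfl rfl
    omega

end Entries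

/-! ### Existence and uniqueness of the solution. -/

section Contraction

variable {H : Type*} [NormedAddCommGroup H] [InnerProductSpace ℂ H] [CompleteSpace H]
  {ω : ℝ} {k θ m : ℕ} {e : HilbertBasis ℤ ℂ H} {B X Y : H →L[ℂ] H}

theorem IsHilbertSchmidt.transJm (hθ : θ = 0 ∨ θ = 1) (hX : IsHilbertSchmidt e X) :
    IsHilbertSchmidt e (transJm θ e m X) ∧ hsNorm e (transJm θ e m X) ≤ hsNorm e X := by
  have := hX.of_entry_le (Y := SimilarOperators.transJm θ e m X) zero_le_one fun i j => by
    rw [entry_transJm m hθ hX]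
    split_ifs <;> simp
  rwa [one_mul] at this

/-- The lower bound for the distance between eigenvalues in different blocks. -/
def gapBound (ω : ℝ) (k θ m : ℕ) : ℝ :=
  Real.pi ^ (2 * k) / ω ^ (2 * k) * (8 * (2 * m + 1) * (2 * (m : ℝ) + θ) ^ (2 * k - 2))

theorem gapBound_pos (hω : 0 < ω) (hm₀ : 0 < 2 * m + θ) : 0 < gapBound ω k θ m := by
  have : (0 : ℝ) < 2 * (m : ℝ) + θ := by exact_mod_cast hm₀
  unfold gapBound
  positivity

/-- The factor `8` is the one contained in `gapBound`, so this is the smallness hypothesis of the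
theorem with denominators cleared. -/
theorem eight_mul_lt_gapBound (hω : 0 < ω) (hm₀ : 0 < 2 * m + θ) {b : ℝ}
    (hm : ω ^ (2 * k) * b /
      (Real.pi ^ (2 * k) * (2 * (m : ℝ) + 1) * (2 * (m : ℝ) + θ) ^ (2 * k - 2)) < 1) :
    8 * b < gapBound ω k θ m := by
  have h0 : (0 : ℝ) < 2 * (m : ℝ) + θ := by exact_mod_cast hm₀
  have hω2 : 0 < ω ^ (2 * k) := by positivity
  rw [div_lt_one (by positivity)] at hm
  unfold gapBound
  rw [div_mul_eq_mul_div, lt_div_iff₀ hω2]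
  linarith

theorem IsHilbertSchmidt.transΓm (hω : 0 < ω) (hk : 1 < k) (hθ : θ = 0 ∨ θ = 1)
    (hm₀ : 0 < 2 * m + θ) (hX : IsHilbertSchmidt e X) :
    IsHilbertSchmidt e (transΓm ω k θ e m X) ∧
      hsNorm e (transΓm ω k θ e m X) ≤ (gapBound ω k θ m)⁻¹ * hsNorm e X := by
  have hg := gapBound_pos (k := k) hω hm₀
  refine hX.of_entry_le (by positivity) fun i j => ?_
  rw [entry_transΓm m hω hk hθ hX]
  split_ifs with h
  · rw [norm_zero]; positivity
  · rw [norm_mul, norm_inv, Complex.norm_real]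
    exact mul_le_mul_of_nonneg_right (inv_anti₀ hg (abs_lam_sub_lam_ge' hω hk hθ h))
      (norm_nonneg _)

theorem transJm_sub (hθ : θ = 0 ∨ θ = 1) (hX : IsHilbertSchmidt e X)
    (hY : IsHilbertSchmidt e Y) :
    transJm θ e m (X - Y) = transJm θ e m X - transJm θ e m Y := by
  refine ext_entries e fun i j => ?_
  simp only [sub_apply, inner_sub_right, entry_transJm m hθ hX, entry_transJm m hθ hY,
    entry_transJm m hθ (hX.sub hY).1]
  split_ifs <;> simp

theorem transΓm_sub (hω : 0 < ω) (hk : 1 < k) (hθ : θ = 0 ∨ θ = 1) (hX : IsHilbertSchmidt e X)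
    (hY : IsHilbertSchmidt e Y) :
    transΓm ω k θ e m (X - Y) = transΓm ω k θ e m X - transΓm ω k θ e m Y := by
  refine ext_entries e fun i j => ?_
  simp only [sub_apply, inner_sub_right, entry_transΓm m hω hk hθ hX,
    entry_transΓm m hω hk hθ hY, entry_transΓm m hω hk hθ (hX.sub hY).1]
  split_ifs <;> ring

omit [CompleteSpace H] in
theorem hsNorm_le_of_ball (hB : IsHilbertSchmidt e B) (hX : IsHilbertSchmidt e X)
    (h : hsNorm e (X - B) ≤ 3 * hsNorm e B) : hsNorm e X ≤ 4 * hsNorm e B := by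
  have := ((hX.sub hB).1.add hB).2
  rw [sub_add_cancel] at this
  linarith

variable (hω : 0 < ω) (hk : 1 < k) (hθ : θ = 0 ∨ θ = 1) (hm₀ : 0 < 2 * m + θ)
  (hB : IsHilbertSchmidt e B) (hgap : 8 * hsNorm e B < gapBound ω k θ m)
include hω hk hθ hm₀ hB hgap

/-- In the ball `‖X‖₂ ≤ 4 ‖B‖₂`, while `Γ_m` divides entries by more than `8 ‖B‖₂`. -/
theorem hsNorm_transΓm_le_half (hX : IsHilbertSchmidt e X)
    (hXB : hsNorm e (X - B) ≤ 3 * hsNorm e B) :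
    hsNorm e (transΓm ω k θ e m X) ≤ 1 / 2 := by
  have hg := gapBound_pos (k := k) hω hm₀
  refine (hX.transΓm hω hk hθ hm₀).2.trans ?_
  rw [inv_mul_le_iff₀ hg]
  linarith [hsNorm_le_of_ball hB hX hXB]

/-- The three terms of `Φ(X) - B` contribute at most `1/2`, `1/2` and `1/4` times `‖B‖₂`, well below
`3`. -/
theorem mapΦ_maps_ball (hX : IsHilbertSchmidt e X) (hXB : hsNorm e (X - B) ≤ 3 * hsNorm e B) :
    IsHilbertSchmidt e (mapΦ ω k θ e m B X) ∧
      hsNorm e (mapΦ ω k θ e m B X - B) ≤ 3 * hsNorm e B := by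
  have hG := (hX.transΓm (e := e) hω hk hθ hm₀).1
  have hG2 := hsNorm_transΓm_le_half hω hk hθ hm₀ hB hgap hX hXB
  unfold mapΦ
  set G := transΓm ω k θ e m X
  have hJB := hB.transJm (m := m) hθ
  have h1 := hB.comp hG
  have h2 := hG.comp hJB.1
  have hJ := h1.1.transJm (m := m) hθ
  have h3 := hG.comp hJ.1
  have h12 := h1.1.sub h2.1
  have h123 := h12.1.sub h3.1
  refine ⟨(h123.1.add hB).1, ?_⟩
  rw [add_sub_cancel_right]
  have hb : 0 ≤ hsNorm e B := hsNorm_nonneg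
  have hg : 0 ≤ hsNorm e G := hsNorm_nonneg
  have e1 : hsNorm e (B ∘L G) ≤ hsNorm e B * (1 / 2) :=
    h1.2.trans (mul_le_mul_of_nonneg_left hG2 hb)
  have e2 : hsNorm e (G ∘L transJm θ e m B) ≤ 1 / 2 * hsNorm e B :=
    h2.2.trans (mul_le_mul hG2 hJB.2 hsNorm_nonneg (by norm_num))
  have e3 : hsNorm e (G ∘L transJm θ e m (B ∘L G)) ≤ 1 / 2 * (hsNorm e B * (1 / 2)) :=
    h3.2.trans (mul_le_mul hG2 (hJ.2.trans e1) hsNorm_nonneg (by norm_num))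
  linarith [h123.2, h12.2]

theorem mapΦ_lipschitz (hX : IsHilbertSchmidt e X) (hXB : hsNorm e (X - B) ≤ 3 * hsNorm e B)
    (hY : IsHilbertSchmidt e Y) (hYB : hsNorm e (Y - B) ≤ 3 * hsNorm e B) :
    hsNorm e (mapΦ ω k θ e m B X - mapΦ ω k θ e m B Y) ≤ 1 / 2 * hsNorm e (X - Y) := by
  have hGX := (hX.transΓm (e := e) hω hk hθ hm₀).1
  have hGX2 := hsNorm_transΓm_le_half hω hk hθ hm₀ hB hgap hX hXB
  have hGY := (hY.transΓm (e := e) hω hk hθ hm₀).1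
  have hGY2 := hsNorm_transΓm_le_half hω hk hθ hm₀ hB hgap hY hYB
  have hD := (hX.sub hY).1.transΓm (e := e) hω hk hθ hm₀
  rw [transΓm_sub hω hk hθ hX hY] at hD
  unfold mapΦ
  set G := transΓm ω k θ e m X
  set K := transΓm ω k θ e m Y
  set d := hsNorm e (X - Y)
  have hJB := hB.transJm (m := m) hθ
  have hBG := hB.comp hGX
  have hBD := hB.comp hD.1
  have hJG := hBG.1.transJm (m := m) hθ
  have hJD := hBD.1.transJm (m := m) hθ
  -- The quadratic term is telescoped, so each summand contains `G - K` once. With `‖B‖₂ ‖G - K‖₂ ≤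
  -- d/8` the four summands are at most `d/8`, `d/8`, `d/16` and `d/16`.
  have hsplit : B ∘L G - G ∘L transJm θ e m B - G ∘L transJm θ e m (B ∘L G) + B -
      (B ∘L K - K ∘L transJm θ e m B - K ∘L transJm θ e m (B ∘L K) + B) =
      B ∘L (G - K) - (G - K) ∘L transJm θ e m B - (G - K) ∘L transJm θ e m (B ∘L G) -
        K ∘L transJm θ e m (B ∘L (G - K)) := by
    rw [ContinuousLinearMap.comp_sub, transJm_sub hθ hBG.1 (hB.comp hGY).1]
    simp only [ContinuousLinearMap.comp_sub, ContinuousLinearMap.sub_comp]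
    abel
  rw [hsplit]
  have hb : 0 ≤ hsNorm e B := hsNorm_nonneg
  have hd : 0 ≤ d := hsNorm_nonneg
  have hbD : hsNorm e B * hsNorm e (G - K) ≤ 1 / 8 * d := by
    have hg := gapBound_pos (k := k) hω hm₀
    have h1 : hsNorm e B * (gapBound ω k θ m)⁻¹ ≤ 1 / 8 := by
      rw [← div_eq_mul_inv, div_le_iff₀ hg]; linarith
    calc hsNorm e B * hsNorm e (G - K) ≤ hsNorm e B * ((gapBound ω k θ m)⁻¹ * d) :=
          mul_le_mul_of_nonneg_left hD.2 hb
      _ = hsNorm e B * (gapBound ω k θ m)⁻¹ * d := by ring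
      _ ≤ 1 / 8 * d := mul_le_mul_of_nonneg_right h1 hd
  have t1 := hBD
  have t2 := hD.1.comp hJB.1
  have t3 := hD.1.comp hJG.1
  have t4 := hGY.comp hJD.1
  have u1 := t1.1.sub t2.1
  have u2 := u1.1.sub t3.1
  have u3 := u2.1.sub t4.1
  have e2 : hsNorm e ((G - K) ∘L transJm θ e m B) ≤ hsNorm e (G - K) * hsNorm e B :=
    t2.2.trans (mul_le_mul_of_nonneg_left hJB.2 hsNorm_nonneg)
  have e3 : hsNorm e ((G - K) ∘L transJm θ e m (B ∘L G)) ≤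
      hsNorm e (G - K) * (hsNorm e B * (1 / 2)) :=
    t3.2.trans (mul_le_mul_of_nonneg_left
      (hJG.2.trans (hBG.2.trans (mul_le_mul_of_nonneg_left hGX2 hb))) hsNorm_nonneg)
  have e4 : hsNorm e (K ∘L transJm θ e m (B ∘L (G - K))) ≤
      1 / 2 * (hsNorm e B * hsNorm e (G - K)) :=
    t4.2.trans (mul_le_mul hGY2 (hJD.2.trans hBD.2) hsNorm_nonneg (by norm_num))
  have e1 := t1.2
  linarith [u1.2, u2.2, u3.2]

theorem existsUnique_isSolution : ∃! X : H →L[ℂ] H, IsSolution ω k θ e m B X :=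
  existsUnique_fixedPoint hB (by have : 0 ≤ hsNorm e B := hsNorm_nonneg
                                 positivity)
    (by norm_num : (0 : ℝ) ≤ 1 / 2) (by norm_num)
    (fun _ hX hXB => mapΦ_maps_ball hω hk hθ hm₀ hB hgap hX hXB)
    (fun _ _ hX hXB hY hYB => mapΦ_lipschitz hω hk hθ hm₀ hB hgap hX hXB hY hYB)

end Contraction

/-! ### Diagonal operators -/

section Diagonal

variable {ι : Type*} {H : Type*} [NormedAddCommGroup H] [InnerProductSpace ℂ H]
  {g : HilbertBasis ι ℂ H} {l : ι → ℝ} {x y x' y' : H}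

/-- `(x, y)` lies in the graph of the maximal diagonal operator with eigenvalues `l j` and
eigenvectors `g j`. -/
def DiagRel (g : HilbertBasis ι ℂ H) (l : ι → ℝ) (x y : H) : Prop :=
  ∀ j, ⟪g j, y⟫_ℂ = (l j : ℂ) * ⟪g j, x⟫_ℂ

theorem DiagRel.sub (h : DiagRel g l x y) (h' : DiagRel g l x' y') :
    DiagRel g l (x - x') (y - y') := fun j => by
  rw [inner_sub_right, inner_sub_right, h j, h' j]; ring

theorem DiagRel.unique (h : DiagRel g l x y) (h' : DiagRel g l x y') : y = y' :=
  ext_inner_basis g fun j => by rw [h j, h' j]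

/-- The resolvent at `-M` of a nonnegative diagonal operator. -/
theorem exists_compact_resolvent [CompleteSpace H] (g : HilbertBasis ι ℂ H) {M : ℝ}
    (hl : ∀ j, 0 ≤ l j) (hM : 0 < M) (hs : Summable fun j => (l j + M)⁻¹) :
    ∃ R : H →L[ℂ] H, IsCompactOperator R ∧ (∀ y, ‖R y‖ ≤ M⁻¹ * ‖y‖) ∧
      (∀ y, DiagRel g l (R y) (y - (M : ℂ) • R y)) ∧
      ∀ x w, DiagRel g l x w → R (w + (M : ℂ) • x) = x := by
  classical
  set T : ι → H →L[ℂ] H := fun j =>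
    (((l j + M)⁻¹ : ℝ) : ℂ) • InnerProductSpace.rankOne ℂ (g j) (g j)
  have hpos : ∀ j, 0 < l j + M := fun j => add_pos_of_nonneg_of_pos (hl j) hM
  have hT : Summable T := by
    refine Summable.of_norm_bounded hs fun j => ?_
    rw [norm_smul, InnerProductSpace.norm_rankOne, Complex.norm_real,
      g.orthonormal.1 j, Real.norm_of_nonneg (inv_nonneg.mpr (hpos j).le)]
    simp
  have hcoord : ∀ j y, ⟪g j, (∑' i, T i) y⟫_ℂ = ((l j + M : ℝ) : ℂ)⁻¹ * ⟪g j, y⟫_ℂ := by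
    intro j y
    refine (hasSum_entry_tsum hT (g j) y).unique ?_
    convert hasSum_ite_eq j (((l j + M : ℝ) : ℂ)⁻¹ * ⟪g j, y⟫_ℂ) using 2 with i
    rw [smul_apply, InnerProductSpace.rankOne_apply, inner_smul_right, inner_smul_right,
      inner_basis]
    by_cases h : i = j
    · subst h; simp
    · simp [h, Ne.symm h]
  have hne : ∀ j, ((l j + M : ℝ) : ℂ) ≠ 0 := fun j => by exact_mod_cast (hpos j).ne'
  refine ⟨∑' j, T j, ?_, ?_, ?_, ?_⟩
  -- A norm limit of finite rank operators is compact.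
  · refine isCompactOperator_of_tendsto hT.hasSum (Filter.Eventually.of_forall fun F => ?_)
    refine (compactOperator (RingHom.id ℂ) H H).sum_mem fun j _ => ?_
    refine Submodule.smul_mem _ _ ?_
    have : IsCompactOperator (innerSL ℂ (g j)) :=
      isCompactOperator_of_locallyCompactSpace_dom (innerSL ℂ (g j))
    exact this.clm_comp (ContinuousLinearMap.toSpanSingleton ℂ (g j))
  · intro y
    refine norm_le_of_norm_inner_le g (by positivity) fun j => ?_
    rw [hcoord, norm_mul, norm_inv, Complex.norm_real, Real.norm_of_nonneg (hpos j).le]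
    exact mul_le_mul_of_nonneg_right (inv_anti₀ hM (by linarith [hl j])) (norm_nonneg _)
  · intro y j
    rw [inner_sub_right, inner_smul_right, hcoord]
    have := hne j
    push_cast at this ⊢
    field_simp
    ring
  · intro x w h
    refine ext_inner_basis g fun j => ?_
    rw [hcoord, inner_add_right, inner_smul_right, h j]
    have := hne j
    push_cast at this ⊢
    field_simp

end Diagonal

/-! ### The unperturbed operator -/

section Spectrum

variable {H : Type*} [NormedAddCommGroup H] [InnerProductSpace ℂ H] [CompleteSpace H]
  {ω : ℝ} {k θ : ℕ} {e : HilbertBasis ℤ ℂ H} {A : H →ₗ.[ℂ] H}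

/-- Normality identifies `A` with the maximal diagonal operator. Since `D(A) = D(A*)`, each `e_j`
lies in `D(A*)` and `A* e_j = λ_j e_j`, which gives the coordinates of `A x`. Conversely the partial
sums of the basis expansions lie in the graph, which is closed. -/
theorem IsUnperturbed.mem_graph_iff (hA : IsUnperturbed ω k θ e A) {x y : H} :
    (x, y) ∈ A.graph ↔ DiagRel e (lam ω k θ) x y := by
  obtain ⟨⟨hdense, hclosed, hdom, -⟩, heig⟩ := hA
  constructor
  · intro hxy j
    obtain ⟨⟨x, hx⟩, rfl, rfl⟩ := (LinearPMap.mem_graph_iff A).mp hxy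
    have hadj := A.adjoint_isFormalAdjoint hdense
    have hj : e j ∈ A.adjoint.domain := hdom ▸ (heig j).1
    have hw : A.adjoint ⟨e j, hj⟩ = ((lam ω k θ j : ℝ) : ℂ) • e j := by
      refine ext_inner_basis e fun i => ?_
      obtain ⟨hi, hAi⟩ := heig i
      have h1 := hadj ⟨e j, hj⟩ ⟨e i, hi⟩
      rw [hAi, inner_smul_right] at h1
      rw [← inner_conj_symm, h1, map_mul, inner_conj_symm, Complex.conj_ofReal, inner_smul_right,
        inner_basis]
      split_ifs with hij
      · rw [hij]
      · simp
    have h2 := hadj ⟨e j, hj⟩ ⟨x, hx⟩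
    rw [hw, inner_smul_left, Complex.conj_ofReal] at h2
    exact h2.symm
  · intro h
    have hx := e.hasSum_repr x
    have hy := e.hasSum_repr y
    refine IsClosed.mem_of_tendsto hclosed (hx.prodMk hy) (Filter.Eventually.of_forall fun F => ?_)
    refine Submodule.sum_mem A.graph fun j _ => ?_
    obtain ⟨hj, hAj⟩ := heig j
    rw [HilbertBasis.repr_apply_apply, HilbertBasis.repr_apply_apply, h j, mul_comm, mul_smul]
    refine A.graph.smul_mem (⟪e j, x⟫_ℂ) (x := (e j, ((lam ω k θ j : ℝ) : ℂ) • e j)) ?_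
    rw [← hAj]
    exact A.mem_graph ⟨e j, hj⟩

theorem inResolventSet_subBounded_iff {E : Type*} [NormedAddCommGroup E] [NormedSpace ℂ E]
    {T : E →ₗ.[ℂ] E} {C : E →L[ℂ] E} {z : ℂ} :
    InResolventSet (subBounded T C) z ↔ ∃ R : E →L[ℂ] E,
      (∀ y, (R y, y + C (R y) + z • R y) ∈ T.graph) ∧
      ∀ x w, (x, w) ∈ T.graph → R (w - C x - z • x) = x := by
  refine exists_congr fun R => and_congr (forall_congr' fun y => ?_) ⟨fun h x w hxw => ?_,
    fun h x => h x _ (T.mem_graph x)⟩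
  · rw [LinearPMap.mem_graph_iff]
    constructor
    · rintro ⟨h, hy⟩
      refine ⟨⟨R y, h⟩, rfl, ?_⟩
      have hy' : T ⟨R y, h⟩ - C (R y) - z • R y = y := hy
      change T ⟨R y, h⟩ = y + C (R y) + z • R y
      nth_rewrite 2 [← hy']
      abel
    · rintro ⟨⟨x, hx⟩, rfl, h2⟩
      refine ⟨hx, ?_⟩
      change T ⟨R y, hx⟩ - C (R y) - z • R y = y
      have h3 : T ⟨R y, hx⟩ = y + C (R y) + z • R y := h2
      rw [h3]
      abel
  · obtain ⟨x, rfl, rfl⟩ := (LinearPMap.mem_graph_iff T).mp hxw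
    exact h x

/-- The spectrum of a bounded perturbation of the unperturbed operator consists of eigenvalues. -/
theorem IsUnperturbed.pSpectrum_subBounded (hA : IsUnperturbed ω k θ e A) (hω : 0 < ω)
    (hk : 1 < k) (hθ : θ = 0 ∨ θ = 1) (C : H →L[ℂ] H) :
    pSpectrum (subBounded A C) =
      {z | ∃ x, x ≠ 0 ∧ DiagRel e (lam ω k θ) x (C x + z • x)} := by
  ext z
  simp only [pSpectrum, Set.mem_ofPred_eq, inResolventSet_subBounded_iff, hA.mem_graph_iff]
  constructor
  · intro hz
    by_contra! hx
    refine hz ?_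
    obtain ⟨R, hcomp, -, hR1, hR2⟩ := exists_compact_resolvent e (lam_nonneg hω) one_pos
      (summable_inv_lam_add hω hk hθ one_pos)
    simp only [Complex.ofReal_one, one_smul] at hR1 hR2
    -- With `R = (A + 1)⁻¹` one has `A - C - z = (1 - D R)(A + 1)` and `D R` is compact. By the
    -- Fredholm alternative either `D R u = u` for some `u ≠ 0`, and `R u` is an eigenvector, or `R
    -- (1 - D R)⁻¹` is the resolvent.
    set D : H →L[ℂ] H := C + (z + 1) • ContinuousLinearMap.id ℂ H with hD
    have hDapp : ∀ v, D v = C v + (z • v + v) := fun v => by simp [hD, add_smul]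
    have hK : IsCompactOperator (D ∘L R) := hcomp.clm_comp D
    rcases hK.hasEigenvalue_or_mem_resolventSet one_ne_zero with h | h
    · obtain ⟨u, hu⟩ := h.exists_hasEigenvector
      have hu1 : D (R u) = u := by simpa using hu.apply_eq_smul
      refine absurd ?_ (hx (R u) fun h0 => hu.2 ?_)
      · have := hR1 u
        rwa [show u - R u = C (R u) + z • R u by nth_rewrite 1 [← hu1]; rw [hDapp]; abel] at this
      · rw [← hu1, h0, map_zero]
    · rw [spectrum.mem_resolventSet_iff, map_one] at h
      obtain ⟨N, hN⟩ := h
      have hN1 : ∀ y, (↑N⁻¹ : H →L[ℂ] H) y - D (R ((↑N⁻¹ : H →L[ℂ] H) y)) = y := fun y => by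
        have h1 := congrArg (fun S : H →L[ℂ] H => S y) N.mul_inv
        rw [hN] at h1
        exact h1
      have hN2 : ∀ y, (↑N⁻¹ : H →L[ℂ] H) (y - D (R y)) = y := fun y => by
        have h1 := congrArg (fun S : H →L[ℂ] H => S y) N.inv_mul
        rw [hN] at h1
        exact h1
      refine ⟨R ∘L (↑N⁻¹ : H →L[ℂ] H), fun y => ?_, fun x w hxw => ?_⟩
      · have h1 := hR1 ((↑N⁻¹ : H →L[ℂ] H) y)
        have h2 := hN1 y
        rw [hDapp] at h2
        rw [ContinuousLinearMap.comp_apply]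
        set u := (↑N⁻¹ : H →L[ℂ] H) y
        rwa [show y + C (R u) + z • R u = u - R u by nth_rewrite 1 [← h2]; abel]
      · have h1 := hR2 x w hxw
        have h2 := hN2 (w + x)
        rw [h1, hDapp] at h2
        rw [ContinuousLinearMap.comp_apply,
          show w - C x - z • x = w + x - (C x + (z • x + x)) by abel, h2, h1]
  · rintro ⟨x, hx, hxD⟩ ⟨R, -, hR⟩
    have := hR x _ hxD
    rw [show C x + z • x - C x - z • x = 0 by abel, map_zero] at this
    exact hx this.symm

end Spectrum

/-! ### Transport of eigenvectors under similarity. -/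

section Similarity

variable {H : Type*} [NormedAddCommGroup H] [InnerProductSpace ℂ H] [CompleteSpace H]

theorem surjective_one_sub {T : H →L[ℂ] H} (hT : ‖T‖ < 1) (y : H) : ∃ x, x - T x = y := by
  obtain ⟨N, hN⟩ := isUnit_one_sub_of_norm_lt_one hT
  refine ⟨(↑N⁻¹ : H →L[ℂ] H) y, ?_⟩
  have h1 := congrArg (fun S : H →L[ℂ] H => S y) N.mul_inv
  rw [hN] at h1
  exact h1

omit [CompleteSpace H] in
theorem eq_zero_of_add_eq_zero {T : H →L[ℂ] H} (hT : ‖T‖ < 1) {x : H} (h : x + T x = 0) :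
    x = 0 := by
  have h1 : ‖x‖ ≤ ‖T‖ * ‖x‖ := by
    nth_rewrite 1 [eq_neg_of_add_eq_zero_left h]
    rw [norm_neg]
    exact T.le_opNorm x
  by_contra hx
  have : 0 < ‖x‖ := norm_pos_iff.mpr hx
  nlinarith

variable {ι : Type*} {g : HilbertBasis ι ℂ H} {l : ι → ℝ} {B G N O : H →L[ℂ] H}

/-- If `A` is diagonal, `A G - G A = O` and `B (1 + G) = (1 + G) N + O` with `‖G‖ < 1`, then
`A - B` and `A - N` have the same eigenvalues. -/
theorem exists_eigenvector_iff_of_similar (hl : ∀ j, 0 ≤ l j)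
    (hs : ∀ M, 0 < M → Summable fun j => (l j + M)⁻¹) (hG : ‖G‖ < 1)
    (hcomm : ∀ i j, ((l i : ℂ) - l j) * ⟪g i, G (g j)⟫_ℂ = ⟪g i, O (g j)⟫_ℂ)
    (hsim : ∀ x, B (x + G x) = N x + G (N x) + O x) (z : ℂ) :
    (∃ x, x ≠ 0 ∧ DiagRel g l x (B x + z • x)) ↔ ∃ x, x ≠ 0 ∧ DiagRel g l x (N x + z • x) := by
  -- `1 + G` preserves the domain of `A` and `A (1 + G) x = (1 + G) A x + O x`. This is the
  -- commutator identity for the entries, summed along each row.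
  have intertwine : ∀ {x w}, DiagRel g l x w → DiagRel g l (x + G x) (w + G w + O x) := by
    intro x w h i
    have h1 := hasSum_entry_mul g G w i
    have h2 := hasSum_entry_mul g O x i
    have h3 := (hasSum_entry_mul g G x i).mul_left (l i : ℂ)
    have h4 : ⟪g i, G w⟫_ℂ + ⟪g i, O x⟫_ℂ = (l i : ℂ) * ⟪g i, G x⟫_ℂ := by
      refine (h1.add h2).unique (h3.congr_fun fun j => ?_)
      rw [h j, ← hcomm i j]; ring
    rw [inner_add_right, inner_add_right, inner_add_right, h i, add_assoc, h4]; ring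
  have hinj : ∀ {x}, x + G x = 0 → x = 0 := fun h => eq_zero_of_add_eq_zero hG h
  have hsurj : ∀ y, ∃ x, x + G x = y := fun y => by
    obtain ⟨x, hx⟩ := surjective_one_sub (T := -G) (by rwa [norm_neg]) y
    exact ⟨x, by simpa using hx⟩
  -- `1 + G` maps the domain onto itself, which invertibility alone does not give. For `M` large, `A
  -- - N + M` and `A - B + M` are injective and onto by a Neumann series. Choose `u` with `(1 + G) u
  -- = (A - B + M) w` and solve `(A - N + M) x = u`; then `A - B + M` takes the same value at `(1 +
  -- G) x` and at `w`.
  have hdom : ∀ {w w'}, DiagRel g l w w' → ∃ x y, x + G x = w ∧ DiagRel g l x y := by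
    intro w w' hw
    set M : ℝ := ‖B‖ + ‖N‖ + 1 with hM
    have hM0 : 0 < M := by positivity
    obtain ⟨R, -, hRn, hR1, hR2⟩ := exists_compact_resolvent g hl hM0 (hs M hM0)
    have hsmall : ∀ C : H →L[ℂ] H, ‖C‖ < M → ‖C ∘L R‖ < 1 := fun C hC => by
      have h1 : ‖R‖ ≤ M⁻¹ := R.opNorm_le_bound (by positivity) hRn
      calc ‖C ∘L R‖ ≤ ‖C‖ * ‖R‖ := C.opNorm_comp_le R
        _ ≤ ‖C‖ * M⁻¹ := mul_le_mul_of_nonneg_left h1 (norm_nonneg _)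
        _ < 1 := by rwa [← div_eq_mul_inv, div_lt_one hM0]
    obtain ⟨u, hu⟩ := hsurj (w' - B w + (M : ℂ) • w)
    obtain ⟨p, hp⟩ := surjective_one_sub (hsmall N (by have := norm_nonneg B; linarith)) u
    rw [ContinuousLinearMap.comp_apply] at hp
    refine ⟨R p, _, ?_, hR1 p⟩
    have hD := (intertwine (hR1 p)).sub hw
    have hpu : p = u + N (R p) := by rw [← hp]; abel
    set x := R p
    have hw' : w' = u + G u + B w - (M : ℂ) • w := by rw [hu]; abel
    have hval : p - (M : ℂ) • x + G (p - (M : ℂ) • x) + O x - w' =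
        B (x + G x - w) - (M : ℂ) • (x + G x - w) := by
      rw [hw', map_sub B, hsim, hpu]
      simp only [map_sub, map_add, map_smul, smul_sub, smul_add]
      abel
    rw [hval] at hD
    have h5 := hR2 _ _ hD
    rw [sub_add_cancel] at h5
    set s := x + G x - w
    have hBs : B s = 0 := by
      refine eq_zero_of_add_eq_zero (T := -(B ∘L R)) ?_ ?_
      · rw [norm_neg]
        exact hsmall B (by have := norm_nonneg N; linarith)
      · rw [neg_apply, ContinuousLinearMap.comp_apply, h5, add_neg_cancel]
    rw [hBs, map_zero] at h5
    exact sub_eq_zero.mp h5.symm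
  constructor
  · rintro ⟨w, hw0, hw⟩
    obtain ⟨x, y, rfl, hxy⟩ := hdom hw
    refine ⟨x, fun h => hw0 (by simp [h]), ?_⟩
    have h1 := (intertwine hxy).unique hw
    rw [hsim] at h1
    have h2 : y - N x - z • x = 0 := by
      refine hinj ?_
      have h3 := sub_eq_zero.mpr h1
      rw [← h3]
      simp only [map_sub, map_smul, smul_add]
      abel
    rwa [show y = N x + z • x by rw [← sub_eq_zero, ← h2]; abel] at hxy
  · rintro ⟨x, hx0, hx⟩
    refine ⟨x + G x, fun h => hx0 (hinj h), ?_⟩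
    have := intertwine hx
    rw [hsim]
    convert this using 1
    simp only [map_add, map_smul, smul_add]
    abel

end Similarity

/-! ### From the nonlinear equation to block diagonalisation. -/

section Solution

variable {H : Type*} [NormedAddCommGroup H] [InnerProductSpace ℂ H] [CompleteSpace H]
  {ω : ℝ} {k θ m : ℕ} {e : HilbertBasis ℤ ℂ H} {B X : H →L[ℂ] H}
  (hω : 0 < ω) (hk : 1 < k) (hθ : θ = 0 ∨ θ = 1) (hm₀ : 0 < 2 * m + θ)
  (hB : IsHilbertSchmidt e B)
include hω hk hθ hm₀ hB

-- In the matrix product, the first factor vanishes inside blocks and the second outside them, so no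
-- product of entries survives on a diagonal block.
omit hm₀ hB in
theorem entry_transΓm_comp_transJm {Y : H →L[ℂ] H} (hX : IsHilbertSchmidt e X)
    (hY : IsHilbertSchmidt e Y) {i j : ℤ} (hij : blk θ m i = blk θ m j) :
    ⟪e i, (transΓm ω k θ e m X ∘L transJm θ e m Y) (e j)⟫_ℂ = 0 := by
  refine (hasSum_entry_mul e (transΓm ω k θ e m X) (transJm θ e m Y (e j)) i).unique ?_
  convert hasSum_zero with p
  rw [entry_transΓm m hω hk hθ hX, entry_transJm m hθ hY]
  split_ifs <;> simp_all

/-- The block diagonal part of a solution. -/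
theorem IsSolution.transJm_eq (hX : IsSolution ω k θ e m B X) :
    transJm θ e m X = transJm θ e m B + transJm θ e m (B ∘L transΓm ω k θ e m X) := by
  obtain ⟨hX, -, heq⟩ := hX
  have hG := (hX.transΓm (e := e) hω hk hθ hm₀).1
  have hBG := (hB.comp hG).1
  refine ext_entries e fun i j => ?_
  rw [add_apply, inner_add_right, entry_transJm m hθ hX, entry_transJm m hθ hB,
    entry_transJm m hθ hBG]
  split_ifs with hij
  · nth_rewrite 1 [heq]
    unfold mapΦ
    rw [add_apply, sub_apply, sub_apply, inner_add_right, inner_sub_right, inner_sub_right,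
      entry_transΓm_comp_transJm hω hk hθ hX hB hij,
      entry_transΓm_comp_transJm hω hk hθ hX hBG hij]
    ring
  · simp

/-- By `transJm_eq` the two terms of the equation with `Γ_m X` on the left combine to `(Γ_m X)(J_m
X)`, leaving `X = B + B Γ_m X - (Γ_m X)(J_m X)`. -/
theorem IsSolution.similarity (hX : IsSolution ω k θ e m B X) (x : H) :
    B (x + transΓm ω k θ e m X x) = transJm θ e m X x +
      transΓm ω k θ e m X (transJm θ e m X x) + (X - transJm θ e m X) x := by
  have hJ := hX.transJm_eq hω hk hθ hm₀ hB
  have h1 : X x = mapΦ ω k θ e m B X x := by rw [← hX.2.2]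
  have h2 : transJm θ e m X x = transJm θ e m B x +
      transJm θ e m (B ∘L transΓm ω k θ e m X) x := by rw [hJ]; rfl
  have h3 : mapΦ ω k θ e m B X x = B (transΓm ω k θ e m X x) -
      transΓm ω k θ e m X (transJm θ e m B x) -
      transΓm ω k θ e m X (transJm θ e m (B ∘L transΓm ω k θ e m X) x) + B x := rfl
  rw [sub_apply, h1, h3, h2]
  simp only [map_add]
  abel

theorem IsSolution.pSpectrum_eq {A : H →ₗ.[ℂ] H} (hA : IsUnperturbed ω k θ e A)
    (hgap : 8 * hsNorm e B < gapBound ω k θ m) (hX : IsSolution ω k θ e m B X) :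
    pSpectrum (subBounded A B) =
      {z | ∃ x, x ≠ 0 ∧ DiagRel e (lam ω k θ) x (transJm θ e m X x + z • x)} := by
  rw [hA.pSpectrum_subBounded hω hk hθ]
  ext z
  refine exists_eigenvector_iff_of_similar (G := transΓm ω k θ e m X) (lam_nonneg hω)
    (fun M hM => summable_inv_lam_add hω hk hθ hM) ?_ (fun i j => ?_)
    (hX.similarity hω hk hθ hm₀ hB) z
  · have h1 := (hX.1.transΓm (e := e) hω hk hθ hm₀).1.norm_le
    linarith [hsNorm_transΓm_le_half hω hk hθ hm₀ hB hgap hX.1 hX.2.1]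
  -- The commutator of `A` with `Γ_m X` is `X - J_m X`: both vanish inside a block, and outside the
  -- factor `λ_i - λ_j` cancels the division.
  · rw [sub_apply, inner_sub_right, entry_transΓm m hω hk hθ hX.1, entry_transJm m hθ hX.1]
    split_ifs with hij
    · simp
    · have : (lam ω k θ i : ℂ) - lam ω k θ j ≠ 0 := by
        rw [sub_ne_zero]
        norm_cast
        intro h
        rw [lam_eq_lam_iff hω hk hθ] at h
        exact hij (by unfold blk; rw [h])
      push_cast
      field_simp
      ring

end Solution

/-! ### Everywhere defined operators in finite dimension. -/

section FiniteDimensional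

variable {E : Type*} [NormedAddCommGroup E] [NormedSpace ℂ E] [FiniteDimensional ℂ E]

theorem mem_pSpectrum_iff_of_domain_eq_top {T : E →ₗ.[ℂ] E} (hT : ∀ x, x ∈ T.domain) {z : ℂ} :
    z ∈ pSpectrum T ↔ ∃ x : E, x ≠ 0 ∧ T ⟨x, hT x⟩ = z • x := by
  constructor
  · intro hz
    by_contra! hx
    refine hz ?_
    set f : E →ₗ[ℂ] E := T.toFun ∘ₗ LinearMap.codRestrict T.domain LinearMap.id hT -
      z • LinearMap.id with hf
    have hfx : ∀ x, f x = T ⟨x, hT x⟩ - z • x := fun x => rfl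
    have hinj : Function.Injective f := by
      rw [← LinearMap.ker_eq_bot, LinearMap.ker_eq_bot']
      intro x h0
      by_contra hne
      rw [hfx, sub_eq_zero] at h0
      exact hx x hne h0
    set L := LinearEquiv.ofInjectiveEndo f hinj
    refine ⟨LinearMap.toContinuousLinearMap (L.symm : E →ₗ[ℂ] E), fun y => ?_, fun x => ?_⟩
    · refine ⟨hT _, ?_⟩
      exact L.apply_symm_apply y
    · exact L.symm_apply_apply (x : E)
  · rintro ⟨x, hx, hxz⟩ ⟨R, -, hR⟩
    have := hR ⟨x, hT x⟩
    rw [hxz, sub_self, map_zero] at this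
    exact hx this.symm

end FiniteDimensional

/-! ### Spectra of compressions to coordinate subspaces. -/

section Compressed

variable {H : Type*} [NormedAddCommGroup H] [InnerProductSpace ℂ H] [CompleteSpace H]
  {ω : ℝ} {k θ : ℕ} {e : HilbertBasis ℤ ℂ H} {A : H →ₗ.[ℂ] H} {P X : H →L[ℂ] H} {F : Finset ℤ}

/-- `P` is the coordinate projection onto the span of the `e i`, `i ∈ F`. -/
def IsCoordProj (e : HilbertBasis ℤ ℂ H) (F : Finset ℤ) (P : H →L[ℂ] H) : Prop :=
  ∀ i v, ⟪e i, P v⟫_ℂ = if i ∈ F then ⟪e i, v⟫_ℂ else 0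

omit [CompleteSpace H] in
theorem IsCoordProj.idem (hP : IsCoordProj e F P) (v : H) : P (P v) = P v :=
  ext_inner_basis e fun i => by rw [hP, hP]; split_ifs <;> rfl

omit [CompleteSpace H] in
theorem IsCoordProj.mem_range_iff (hP : IsCoordProj e F P) {v : H} :
    v ∈ LinearMap.range (P : H →ₗ[ℂ] H) ↔ P v = v :=
  ⟨by rintro ⟨u, rfl⟩; exact hP.idem u, fun h => ⟨v, h⟩⟩

omit [CompleteSpace H] in
theorem IsCoordProj.norm_le (hP : IsCoordProj e F P) (v : H) : ‖P v‖ ≤ ‖v‖ := by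
  have := norm_le_of_norm_inner_le e zero_le_one (u := P v) (v := v) fun i => by
    rw [hP]; split_ifs <;> simp
  rwa [one_mul] at this

omit [CompleteSpace H] in
theorem IsCoordProj.apply_eq_sum (hP : IsCoordProj e F P) (v : H) :
    P v = ∑ i ∈ F, ⟪e i, v⟫_ℂ • e i := by
  refine ext_inner_basis e fun i => ?_
  rw [hP, inner_sum]
  simp only [inner_smul_right, inner_basis, mul_ite, mul_one, mul_zero, Finset.sum_ite_eq]

omit [CompleteSpace H] in
theorem IsCoordProj.finiteDimensional_range (hP : IsCoordProj e F P) :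
    FiniteDimensional ℂ (LinearMap.range (P : H →ₗ[ℂ] H)) := by
  have hle : LinearMap.range (P : H →ₗ[ℂ] H) ≤ Submodule.span ℂ (e '' (F : Set ℤ)) := by
    rintro _ ⟨v, rfl⟩
    change P v ∈ _
    rw [hP.apply_eq_sum]
    exact Submodule.sum_mem _ fun i hi =>
      Submodule.smul_mem _ _ (Submodule.subset_span ⟨i, hi, rfl⟩)
  have := FiniteDimensional.span_of_finite ℂ (F.finite_toSet.image e)
  exact Submodule.finiteDimensional_of_le hle

/-- `Im P` is spanned by finitely many eigenvectors of `A`, so it lies in `D(A)` and is invariant;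
the restriction is everywhere defined in finite dimension and its spectrum consists of eigenvalues.
-/
theorem IsUnperturbed.mem_compressedSpectrum_iff (hA : IsUnperturbed ω k θ e A)
    (hP : IsCoordProj e F P) {z : ℂ} :
    z ∈ compressedSpectrum A P X ↔
      ∃ x, x ≠ 0 ∧ P x = x ∧ DiagRel e (lam ω k θ) x (P (X x) + z • x) := by
  have := hP.finiteDimensional_range
  have hgraph : ∀ x, P x = x → ∃ y, P y = y ∧ (x, y) ∈ A.graph := by
    intro x hx
    have hy : ∀ j, ⟪e j, ∑ i ∈ F, ((lam ω k θ i : ℝ) : ℂ) • ⟪e i, x⟫_ℂ • e i⟫_ℂ =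
        (lam ω k θ j : ℂ) * ⟪e j, x⟫_ℂ := fun j => by
      rw [inner_sum]
      simp only [inner_smul_right, inner_basis, mul_ite, mul_one, mul_zero, Finset.sum_ite_eq]
      rw [← hx, hP]
      split_ifs <;> simp
    refine ⟨_, ?_, hA.mem_graph_iff.mpr hy⟩
    refine ext_inner_basis e fun j => ?_
    rw [hP, hy]
    rw [← hx, hP]
    split_ifs <;> simp
  have hdom : ∀ x : LinearMap.range (P : H →ₗ[ℂ] H), ∃ h : (x : H) ∈ A.domain,
      A ⟨x, h⟩ - P (X (P x)) ∈ LinearMap.range (P : H →ₗ[ℂ] H) := by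
    intro x
    have hx := hP.mem_range_iff.mp x.2
    obtain ⟨y, hy, hxy⟩ := hgraph x hx
    obtain ⟨⟨x', hx'⟩, h1, h2⟩ := (LinearPMap.mem_graph_iff A).mp hxy
    obtain rfl : x' = x := h1
    refine ⟨hx', Submodule.sub_mem _ ?_ ⟨_, rfl⟩⟩
    rw [h2]
    exact hP.mem_range_iff.mpr hy
  have hdom' : ∀ x, x ∈ (restrictTo (subBounded A (P ∘L X ∘L P))
      (LinearMap.range (P : H →ₗ[ℂ] H))).domain := hdom
  unfold compressedSpectrum
  rw [mem_pSpectrum_iff_of_domain_eq_top hdom']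
  have hval : ∀ x : LinearMap.range (P : H →ₗ[ℂ] H),
      (restrictTo (subBounded A (P ∘L X ∘L P)) (LinearMap.range (P : H →ₗ[ℂ] H)) ⟨x, hdom' x⟩ =
        z • x) ↔ DiagRel e (lam ω k θ) x (P (X x) + z • (x : H)) := by
    intro x
    have hx := hP.mem_range_iff.mp x.2
    obtain ⟨h, -⟩ := hdom x
    rw [← hA.mem_graph_iff, Subtype.ext_iff]
    change A ⟨x, h⟩ - P (X (P x)) = z • (x : H) ↔ _
    rw [hx, sub_eq_iff_eq_add', LinearPMap.mem_graph_iff]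
    constructor
    · intro h1
      exact ⟨⟨x, h⟩, rfl, h1⟩
    · rintro ⟨⟨x', hx'⟩, h1, h2⟩
      obtain rfl : x' = x := h1
      exact h2
  constructor
  · rintro ⟨x, hx, hxz⟩
    exact ⟨x, fun h => hx (Subtype.ext h), hP.mem_range_iff.mp x.2, (hval x).mp hxz⟩
  · rintro ⟨x, hx, hPx, hxz⟩
    exact ⟨⟨x, hP.mem_range_iff.mpr hPx⟩, fun h => hx (congrArg Subtype.val h), (hval _).mpr hxz⟩

/-- The spectrum of a compression lies within `‖X‖` of the unperturbed eigenvalues. -/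
theorem IsUnperturbed.exists_near (hA : IsUnperturbed ω k θ e A) (hP : IsCoordProj e F P) {z : ℂ}
    (hz : z ∈ compressedSpectrum A P X) : ∃ i ∈ F, ‖((lam ω k θ i : ℝ) : ℂ) - z‖ ≤ ‖X‖ := by
  obtain ⟨x, hx, hPx, hxz⟩ := (hA.mem_compressedSpectrum_iff hP).mp hz
  have hx0 : ∀ i, i ∉ F → ⟪e i, x⟫_ℂ = 0 := fun i hi => by rw [← hPx, hP, if_neg hi]
  have hF : F.Nonempty := by
    by_contra hF
    rw [Finset.not_nonempty_iff_eq_empty] at hF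
    subst hF
    exact hx (ext_inner_basis e fun i => by rw [hx0 i (by simp), inner_zero_right])
  -- If the smallest distance `r` exceeded `‖X‖`, then `(A - z) x = P X x` would give `r ‖x‖ ≤ ‖X‖
  -- ‖x‖`, which is impossible for `x ≠ 0`.
  obtain ⟨i, hiF, hmin⟩ := F.exists_min_image (fun i => ‖((lam ω k θ i : ℝ) : ℂ) - z‖) hF
  refine ⟨i, hiF, ?_⟩
  set r := ‖((lam ω k θ i : ℝ) : ℂ) - z‖
  by_contra! hr
  have hr0 : 0 < r := (norm_nonneg _).trans_lt hr
  have h1 : ‖x‖ ≤ r⁻¹ * ‖P (X x)‖ := by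
    refine norm_le_of_norm_inner_le e (by positivity) fun j => ?_
    rw [← div_eq_inv_mul, le_div_iff₀ hr0]
    by_cases hj : j ∈ F
    · have h2 := hxz j
      rw [inner_add_right, inner_smul_right] at h2
      have h3 : ⟪e j, P (X x)⟫_ℂ = (((lam ω k θ j : ℝ) : ℂ) - z) * ⟪e j, x⟫_ℂ := by
        linear_combination h2
      rw [h3, norm_mul, mul_comm]
      exact mul_le_mul_of_nonneg_right (hmin j hj) (norm_nonneg _)
    · rw [hx0 j hj]; simp
  rw [← div_eq_inv_mul, le_div_iff₀ hr0] at h1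
  have h2 := (hP.norm_le (X x)).trans (X.le_opNorm x)
  have h3 : 0 < ‖x‖ := norm_pos_iff.mpr hx
  nlinarith

/-- The spectrum of a compression is the spectrum of the matrix of the compressed operator. -/
theorem IsUnperturbed.compressedSpectrum_eq_spectrum {κ : Type*} [Fintype κ] [DecidableEq κ]
    (hA : IsUnperturbed ω k θ e A) (hP : IsCoordProj e F P) {f : κ → ℤ}
    (hf : Function.Injective f) (hF : F = Finset.univ.image f) :
    compressedSpectrum A P X = spectrum ℂ (Matrix.of fun a b =>
      (if a = b then ((lam ω k θ (f a) : ℝ) : ℂ) else 0) - ⟪e (f a), X (e (f b))⟫_ℂ) := by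
  have hmem : ∀ i, i ∈ F ↔ ∃ a, f a = i := fun i => by simp [hF]
  have hsum : ∀ (v : H) (a : κ), P v = v →
      ⟪e (f a), X v⟫_ℂ = ∑ b, ⟪e (f a), X (e (f b))⟫_ℂ * ⟪e (f b), v⟫_ℂ := by
    intro v a hv
    nth_rewrite 1 [← hv]
    rw [hP.apply_eq_sum, hF, Finset.sum_image fun _ _ _ _ h => hf h, map_sum, inner_sum]
    refine Finset.sum_congr rfl fun b _ => ?_
    rw [map_smul, inner_smul_right, mul_comm]
  ext z
  rw [hA.mem_compressedSpectrum_iff hP, spectrum.mem_iff, Matrix.isUnit_iff_isUnit_det,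
    isUnit_iff_ne_zero, not_not, ← Matrix.exists_mulVec_eq_zero_iff]
  set N : Matrix κ κ ℂ := Matrix.of fun a b =>
      (if a = b then ((lam ω k θ (f a) : ℝ) : ℂ) else 0) - ⟪e (f a), X (e (f b))⟫_ℂ with hN
  have hmul : ∀ (c : κ → ℂ) (a : κ), ((algebraMap ℂ (Matrix κ κ ℂ) z - N).mulVec c) a =
      z * c a - ((lam ω k θ (f a) : ℝ) : ℂ) * c a +
        ∑ b, ⟪e (f a), X (e (f b))⟫_ℂ * c b := by
    intro c a
    rw [Matrix.sub_mulVec, Pi.sub_apply, Algebra.algebraMap_eq_smul_one, Matrix.smul_mulVec,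
      Matrix.one_mulVec, Pi.smul_apply, smul_eq_mul, hN, Matrix.mulVec, dotProduct]
    simp only [Matrix.of_apply, sub_mul, ite_mul, zero_mul, Finset.sum_sub_distrib,
      Finset.sum_ite_eq, Finset.mem_univ, if_true]
    ring
  constructor
  · rintro ⟨x, hx, hPx, hxz⟩
    refine ⟨fun a => ⟪e (f a), x⟫_ℂ, fun h0 => hx ?_, ?_⟩
    · refine ext_inner_basis e fun i => ?_
      rw [inner_zero_right]
      by_cases hi : i ∈ F
      · obtain ⟨a, rfl⟩ := (hmem i).mp hi
        exact congrFun h0 a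
      · rw [← hPx, hP, if_neg hi]
    · funext a
      rw [hmul, ← hsum x a hPx]
      have h1 := hxz (f a)
      rw [inner_add_right, inner_smul_right, hP, if_pos ((hmem _).mpr ⟨a, rfl⟩)] at h1
      rw [Pi.zero_apply]
      linear_combination h1
  · rintro ⟨c, hc, hcz⟩
    set x : H := ∑ a, c a • e (f a) with hx
    have hxa : ∀ a, ⟪e (f a), x⟫_ℂ = c a := fun a => by
      rw [hx, inner_sum]
      simp only [inner_smul_right, inner_basis, hf.eq_iff, mul_ite, mul_one, mul_zero,
        Finset.sum_ite_eq, Finset.mem_univ, if_true]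
    have hxi : ∀ i, i ∉ F → ⟪e i, x⟫_ℂ = 0 := fun i hi => by
      rw [hx, inner_sum]
      refine Finset.sum_eq_zero fun a _ => ?_
      rw [inner_smul_right, inner_basis, if_neg, mul_zero]
      rintro rfl
      exact hi ((hmem _).mpr ⟨a, rfl⟩)
    have hPx : P x = x := ext_inner_basis e fun i => by
      rw [hP]
      split_ifs with hi
      · rfl
      · rw [hxi i hi]
    refine ⟨x, fun h0 => hc ?_, hPx, fun i => ?_⟩
    · funext a
      rw [← hxa, h0, inner_zero_right]; rfl
    · rw [inner_add_right, inner_smul_right, hP]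
      by_cases hi : i ∈ F
      · rw [if_pos hi]
        obtain ⟨a, rfl⟩ := (hmem i).mp hi
        have h1 := congrFun hcz a
        rw [hmul, Pi.zero_apply] at h1
        simp only [← hxa] at h1
        rw [hsum x a hPx]
        linear_combination h1
      · rw [if_neg hi, hxi i hi]; ring

theorem encard_spectrum_le {κ : Type*} [Fintype κ] [DecidableEq κ] (N : Matrix κ κ ℂ) :
    (spectrum ℂ N).encard ≤ Fintype.card κ := by
  have hsub : spectrum ℂ N ⊆ (N.charpoly.roots.toFinset : Set ℂ) := by
    intro z hz
    rw [Finset.mem_coe, Multiset.mem_toFinset, Polynomial.mem_roots N.charpoly_monic.ne_zero]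
    exact Matrix.mem_spectrum_iff_isRoot_charpoly.mp hz
  refine (Set.encard_le_encard hsub).trans ?_
  rw [Set.encard_coe_eq_coe_finsetCard]
  have h := (Multiset.toFinset_card_le N.charpoly.roots).trans (Polynomial.card_roots' N.charpoly)
  rw [N.charpoly_natDegree_eq_dim] at h
  exact_mod_cast h

theorem IsUnperturbed.encard_compressedSpectrum_le (hA : IsUnperturbed ω k θ e A)
    (hP : IsCoordProj e F P) : (compressedSpectrum A P X).encard ≤ F.card := by
  rw [hA.compressedSpectrum_eq_spectrum hP (f := fun a : F => (a : ℤ)) Subtype.val_injective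
    (by ext i; simp)]
  exact (encard_spectrum_le _).trans (by simp)

end Compressed

/-! ### Decomposition of the spectrum into blocks. -/

section Blocks

variable {H : Type*} [NormedAddCommGroup H] [InnerProductSpace ℂ H]
  {θ m : ℕ} {e : HilbertBasis ℤ ℂ H} {X : H →L[ℂ] H}

theorem isCoordProj_projN (hθ : θ = 0 ∨ θ = 1) (n : ℕ) :
    IsCoordProj e {-(n : ℤ) - θ, (n : ℤ)} (projN θ e n) := fun i v => by
  rw [inner_projN hθ]
  refine if_congr ?_ rfl rfl
  rw [cls_eq_iff hθ]; simp

/-- The indices `n` and `-n-θ` with `n ≤ m` fill an interval of `2m + 1 + θ` integers, whence the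
bound on the number of points of `σ_(m)`. -/
theorem isCoordProj_projUpTo (hθ : θ = 0 ∨ θ = 1) (m : ℕ) :
    IsCoordProj e (Finset.Icc (-(m : ℤ) - θ) m) (projUpTo θ e m) := fun i v => by
  rw [inner_projUpTo hθ]
  refine if_congr ?_ rfl rfl
  rw [Finset.mem_Icc]
  unfold cls
  split_ifs <;> omega

/-- The projection onto the block with index `s ≥ m`. -/
def projBlk (θ : ℕ) (e : HilbertBasis ℤ ℂ H) (m s : ℕ) : H →L[ℂ] H :=
  if s = m then projUpTo θ e m else projN θ e s

theorem inner_projBlk (hθ : θ = 0 ∨ θ = 1) {s : ℕ} (hs : m ≤ s) (i : ℤ) (v : H) :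
    ⟪e i, projBlk θ e m s v⟫_ℂ = if blk θ m i = s then ⟪e i, v⟫_ℂ else 0 := by
  unfold projBlk blk
  split_ifs with h1 h2 h2
  · rw [inner_projUpTo hθ, if_pos (by omega)]
  · rw [inner_projUpTo hθ, if_neg (by omega)]
  · rw [inner_projN hθ, if_pos (by omega)]
  · rw [inner_projN hθ, if_neg (by omega)]

theorem exists_isCoordProj_projBlk (hθ : θ = 0 ∨ θ = 1) {s : ℕ} (hs : m ≤ s) :
    ∃ F : Finset ℤ, IsCoordProj e F (projBlk θ e m s) ∧ ∀ i ∈ F, blk θ m i = s := by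
  unfold projBlk
  split_ifs with h
  · refine ⟨_, isCoordProj_projUpTo hθ m, fun i hi => ?_⟩
    rw [Finset.mem_Icc] at hi
    unfold blk cls
    split_ifs <;> omega
  · refine ⟨_, isCoordProj_projN hθ s, fun i hi => ?_⟩
    have hi' : cls θ i = s := (cls_eq_iff hθ i s).mpr (by simpa using hi)
    unfold blk
    omega

variable [CompleteSpace H] {ω : ℝ} {k : ℕ} {A : H →ₗ.[ℂ] H}

theorem inner_transJm (hθ : θ = 0 ∨ θ = 1) (hX : IsHilbertSchmidt e X) (i : ℤ) (v : H) :
    ⟪e i, transJm θ e m X v⟫_ℂ = ⟪e i, X (projBlk θ e m (blk θ m i) v)⟫_ℂ := by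
  refine (hasSum_entry_mul e (transJm θ e m X) v i).unique
    ((hasSum_entry_mul e X (projBlk θ e m (blk θ m i) v) i).congr_fun fun j => ?_)
  rw [entry_transJm m hθ hX, inner_projBlk hθ (s := blk θ m i) (le_max_right _ _)]
  by_cases h : blk θ m i = blk θ m j
  · rw [if_pos h, if_pos h.symm]
  · rw [if_neg h, if_neg (Ne.symm h)]; ring

/-- The eigenvalues of a block diagonal operator are those of its blocks. -/
theorem IsUnperturbed.eigenvalues_transJm (hA : IsUnperturbed ω k θ e A) (hθ : θ = 0 ∨ θ = 1)
    (hX : IsHilbertSchmidt e X) (z : ℂ) :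
    (∃ x, x ≠ 0 ∧ DiagRel e (lam ω k θ) x (transJm θ e m X x + z • x)) ↔
      ∃ s, m ≤ s ∧ z ∈ compressedSpectrum A (projBlk θ e m s) X := by
  have hQ : ∀ i, m ≤ blk θ m i := fun i => le_max_right _ _
  constructor
  · rintro ⟨x, hx, hxz⟩
    obtain ⟨i, hi⟩ : ∃ i, ⟪e i, x⟫_ℂ ≠ 0 := by
      by_contra! h
      exact hx (ext_inner_basis e fun i => by rw [h i, inner_zero_right])
    refine ⟨blk θ m i, hQ i, ?_⟩
    obtain ⟨F, hF, -⟩ := exists_isCoordProj_projBlk (e := e) hθ (hQ i)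
    refine (hA.mem_compressedSpectrum_iff hF).mpr
      ⟨projBlk θ e m (blk θ m i) x, fun h => hi ?_, hF.idem x, fun j => ?_⟩
    · have := inner_projBlk (e := e) hθ (hQ i) i x
      rwa [h, inner_zero_right, if_pos rfl, eq_comm] at this
    · rw [inner_add_right, inner_smul_right, inner_projBlk hθ (hQ i), inner_projBlk hθ (hQ i)]
      split_ifs with hj
      · have h1 := hxz j
        rw [inner_add_right, inner_smul_right, inner_transJm hθ hX, hj] at h1
        exact h1
      · simp
  · rintro ⟨s, hs, hz⟩
    obtain ⟨F, hF, -⟩ := exists_isCoordProj_projBlk (e := e) hθ hs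
    obtain ⟨x, hx, hPx, hxz⟩ := (hA.mem_compressedSpectrum_iff hF).mp hz
    refine ⟨x, hx, fun j => ?_⟩
    rw [← hxz j, inner_add_right, inner_add_right, inner_transJm hθ hX, inner_projBlk hθ hs]
    split_ifs with hj
    · rw [hj, hPx]
    · have : projBlk θ e m (blk θ m j) x = 0 := by
        refine ext_inner_basis e fun i => ?_
        rw [inner_projBlk hθ (hQ j), inner_zero_right, ← hPx, inner_projBlk hθ hs]
        by_cases h1 : blk θ m i = s
        · rw [if_neg]; rw [h1]; exact Ne.symm hj
        · rw [if_neg h1]; split_ifs <;> rfl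
      rw [this, map_zero, inner_zero_right]

/-- A common point would lie within `‖X‖` of eigenvalues from two different blocks, which are at
least `gapBound` apart. -/
theorem IsUnperturbed.disjoint_blocks (hA : IsUnperturbed ω k θ e A) (hω : 0 < ω) (hk : 1 < k)
    (hθ : θ = 0 ∨ θ = 1) (hX : 2 * ‖X‖ < gapBound ω k θ m) {s t : ℕ} (hs : m ≤ s) (ht : m ≤ t)
    (hst : s ≠ t) :
    Disjoint (compressedSpectrum A (projBlk θ e m s) X)
      (compressedSpectrum A (projBlk θ e m t) X) := by
  rw [Set.disjoint_left]
  intro z hzs hzt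
  obtain ⟨F, hF, hFs⟩ := exists_isCoordProj_projBlk (e := e) hθ hs
  obtain ⟨G, hG, hGt⟩ := exists_isCoordProj_projBlk (e := e) hθ ht
  obtain ⟨i, hi, hiz⟩ := hA.exists_near hF hzs
  obtain ⟨j, hj, hjz⟩ := hA.exists_near hG hzt
  have hne : blk θ m i ≠ blk θ m j := by rwa [hFs i hi, hGt j hj]
  have h1 := abs_lam_sub_lam_ge' (k := k) hω hk hθ hne
  have h2 : |lam ω k θ i - lam ω k θ j| ≤ ‖X‖ + ‖X‖ := by
    rw [← Real.norm_eq_abs, ← Complex.norm_real, Complex.ofReal_sub,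
      ← sub_sub_sub_cancel_right _ _ z]
    exact (norm_sub_le _ _).trans (add_le_add hiz hjz)
  have h3 : gapBound ω k θ m ≤ |lam ω k θ i - lam ω k θ j| := h1
  linarith

end Blocks

/-! ### The `2 × 2` matrices and the estimate of `C_n`. -/

section MatrixEstimate

variable {H : Type*} [NormedAddCommGroup H] [InnerProductSpace ℂ H]
  {ω : ℝ} {k θ m n : ℕ} {e : HilbertBasis ℤ ℂ H} {B X Z : H →L[ℂ] H}

theorem matHSNorm_le_hsNorm (hZ : IsHilbertSchmidt e Z) {f : Fin 2 → ℤ}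
    (hf : Function.Injective f) {C : Matrix (Fin 2) (Fin 2) ℂ}
    (hC : ∀ a b, ‖C a b‖ ≤ ‖⟪e (f a), Z (e (f b))⟫_ℂ‖) : matHSNorm C ≤ hsNorm e Z := by
  refine (Real.sqrt_le_left hsNorm_nonneg).mpr ?_
  -- The swap is needed because `hsNorm` indexes entries as (column, row).
  set φ : Fin 2 × Fin 2 → ℤ × ℤ := fun p => (f p.2, f p.1)
  have hφ : Function.Injective φ := fun p q h => by
    simp only [φ, Prod.mk.injEq, hf.eq_iff] at h
    exact Prod.ext h.2 h.1
  refine le_trans ?_ (hZ.sum_le (Finset.univ.image φ))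
  rw [Finset.sum_image fun _ _ _ _ h => hφ h, Fintype.sum_prod_type]
  exact Finset.sum_le_sum fun a _ => Finset.sum_le_sum fun b _ =>
    pow_le_pow_left₀ (norm_nonneg _) (hC a b) 2

variable [CompleteSpace H] (hω : 0 < ω) (hk : 1 < k) (hθ : θ = 0 ∨ θ = 1) (hm₀ : 0 < 2 * m + θ)
  (hB : IsHilbertSchmidt e B) (hn : m + 1 ≤ n)

omit [CompleteSpace H] in
theorem isHilbertSchmidt_comp_projN (hθ : θ = 0 ∨ θ = 1) (hX : IsHilbertSchmidt e X) :
    IsHilbertSchmidt e (X ∘L projN θ e n) ∧ hsNorm e (X ∘L projN θ e n) ≤ hsNorm e X := by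
  have := hX.of_entry_le (Y := X ∘L projN θ e n) zero_le_one fun i j => by
    rw [ContinuousLinearMap.comp_apply, projN_basis hθ]
    split_ifs <;> simp
  rwa [one_mul] at this

omit [CompleteSpace H] in
theorem isHilbertSchmidt_sub_projN_comp (hθ : θ = 0 ∨ θ = 1) (hX : IsHilbertSchmidt e X) :
    IsHilbertSchmidt e (X - projN θ e n ∘L X) ∧
      hsNorm e (X - projN θ e n ∘L X) ≤ hsNorm e X := by
  have := hX.of_entry_le (Y := X - projN θ e n ∘L X) zero_le_one fun i j => by
    rw [sub_apply, inner_sub_right, ContinuousLinearMap.comp_apply, inner_projN hθ]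
    split_ifs <;> simp
  rwa [one_mul] at this

include hθ hn in
theorem transJm_comp_projN (hX : IsHilbertSchmidt e X) :
    transJm θ e m X ∘L projN θ e n = projN θ e n ∘L X ∘L projN θ e n := by
  refine ext_entries e fun i j => ?_
  rw [entry_projN_comp hθ, ContinuousLinearMap.comp_apply, projN_basis hθ]
  by_cases hj : cls θ j = n
  · rw [if_pos hj, entry_transJm m hθ hX]
    refine if_congr ?_ rfl rfl
    unfold blk
    omega
  · rw [if_neg hj, map_zero, inner_zero_right, if_neg (by tauto)]

include hω hk hθ hn in
theorem projN_comp_transΓm_comp_projN (hX : IsHilbertSchmidt e X) :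
    projN θ e n ∘L transΓm ω k θ e m X ∘L projN θ e n = 0 := by
  refine ext_entries e fun i j => ?_
  rw [entry_projN_comp hθ, entry_transΓm m hω hk hθ hX, zero_apply, inner_zero_right]
  by_cases h : cls θ i = n ∧ cls θ j = n
  · rw [if_pos h, if_pos]
    unfold blk
    omega
  · rw [if_neg h]

include hω hk hθ hn in
/-- `Γ_m X ℙ_n` is controlled by the part of `X ℙ_n` off the diagonal block. -/
theorem hsNorm_transΓm_comp_projN_le_of_gap (hX : IsHilbertSchmidt e X) {r : ℝ} (hr : 0 < r)
    (hgap : ∀ i j, cls θ j = n → cls θ i ≠ n → r ≤ |lam ω k θ i - lam ω k θ j|) :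
    r * hsNorm e (transΓm ω k θ e m X ∘L projN θ e n) ≤
      hsNorm e (X ∘L projN θ e n - projN θ e n ∘L (X ∘L projN θ e n)) := by
  have hS := (isHilbertSchmidt_sub_projN_comp (n := n) hθ
    (isHilbertSchmidt_comp_projN (n := n) hθ hX).1).1
  rw [mul_comm, ← le_div_iff₀ hr, div_eq_inv_mul]
  refine (hS.of_entry_le (by positivity) fun i j => ?_).2
  rw [ContinuousLinearMap.comp_apply, projN_basis hθ, sub_apply, inner_sub_right,
    ContinuousLinearMap.comp_apply, ContinuousLinearMap.comp_apply, inner_projN hθ,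
    ContinuousLinearMap.comp_apply, projN_basis hθ]
  by_cases hj : cls θ j = n
  · rw [if_pos hj, entry_transΓm m hω hk hθ hX]
    by_cases hi : cls θ i = n
    · rw [if_pos, norm_zero]
      · positivity
      · rw [blk, blk, hi, hj]
    · rw [if_neg, if_neg hi, sub_zero, norm_mul, norm_inv, Complex.norm_real]
      · exact mul_le_mul_of_nonneg_right (inv_anti₀ hr (hgap i j hj hi)) (norm_nonneg _)
      · unfold blk; omega
  · rw [if_neg hj, map_zero, inner_zero_right, norm_zero]
    positivity

include hω hk hθ hm₀ hB hn

/-- For `n > m` the eigenspace is a block of its own, so `(J_m Z) ℙ_n = ℙ_n Z ℙ_n`. Hence on the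
right-hand side the solution enters only through `Y = Γ_m X ℙ_n`, in a Riccati-type expression. -/
theorem IsSolution.comp_projN (hX : IsSolution ω k θ e m B X) :
    X ∘L projN θ e n = B ∘L (transΓm ω k θ e m X ∘L projN θ e n) -
      (transΓm ω k θ e m X ∘L projN θ e n) ∘L (B ∘L projN θ e n) -
      (transΓm ω k θ e m X ∘L projN θ e n) ∘L (B ∘L (transΓm ω k θ e m X ∘L projN θ e n)) +
      B ∘L projN θ e n := by
  have hBG := (hB.comp (hX.1.transΓm (e := e) hω hk hθ hm₀).1).1
  have h1 : X ∘L projN θ e n = mapΦ ω k θ e m B X ∘L projN θ e n := by rw [← hX.2.2]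
  rw [h1]
  unfold mapΦ
  rw [ContinuousLinearMap.add_comp, ContinuousLinearMap.sub_comp, ContinuousLinearMap.sub_comp]
  simp only [ContinuousLinearMap.comp_assoc, transJm_comp_projN hθ hn hB,
    transJm_comp_projN hθ hn hBG]

theorem IsSolution.hsNorm_transΓm_comp_projN_le (hgap : 8 * hsNorm e B < gapBound ω k θ m)
    (hX : IsSolution ω k θ e m B X) :
    hsNorm e (transΓm ω k θ e m X ∘L projN θ e n) ≤
      ω ^ (2 * k) / (2 * Real.pi ^ (2 * k) * n * (2 * (n : ℝ) + θ) ^ (2 * k - 2)) *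
        hsNorm e (B ∘L projN θ e n - projN θ e n ∘L B ∘L projN θ e n) := by
  have hG := (hX.1.transΓm (e := e) hω hk hθ hm₀).1
  have hY := isHilbertSchmidt_comp_projN (n := n) hθ hG
  have ht := hY.2.trans (hsNorm_transΓm_le_half hω hk hθ hm₀ hB hgap hX.1 hX.2.1)
  have hBP := isHilbertSchmidt_comp_projN (n := n) hθ hB
  have hn0 : (0 : ℝ) < n := by exact_mod_cast (by omega : 0 < n)
  have hL := hsNorm_transΓm_comp_projN_le_of_gap (m := m) hω hk hθ hn hX.1
    (r := Real.pi ^ (2 * k) / ω ^ (2 * k) * (4 * n * (2 * (n : ℝ) + θ) ^ (2 * k - 2)))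
    (by positivity) (fun i j hj hi => by
      have := abs_lam_sub_lam_ge (k := k) (i := i) (j := j) hω hk hθ (by rwa [hj])
      rwa [hj] at this)
  -- The same estimate with the block gap in place of the local one: it is comparable with `‖B‖₂`
  -- and serves to absorb the terms containing `Y`.
  have hg := hsNorm_transΓm_comp_projN_le_of_gap (m := m) hω hk hθ hn hX.1
    (gapBound_pos (k := k) hω hm₀) (fun i j hj hi => by
      refine abs_lam_sub_lam_ge' (m := m) hω hk hθ ?_
      unfold blk; omega)
  have hPY : projN θ e n ∘L (transΓm ω k θ e m X ∘L projN θ e n) = 0 :=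
    projN_comp_transΓm_comp_projN hω hk hθ hn hX.1
  -- As `ℙ_n Y = 0`, removing the range of `ℙ_n` leaves the two terms that begin with `Y` unchanged.
  have hS : X ∘L projN θ e n - projN θ e n ∘L (X ∘L projN θ e n) =
      (B ∘L (transΓm ω k θ e m X ∘L projN θ e n) -
        projN θ e n ∘L (B ∘L (transΓm ω k θ e m X ∘L projN θ e n))) -
      (transΓm ω k θ e m X ∘L projN θ e n) ∘L (B ∘L projN θ e n) -
      (transΓm ω k θ e m X ∘L projN θ e n) ∘L (B ∘L (transΓm ω k θ e m X ∘L projN θ e n)) +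
      (B ∘L projN θ e n - projN θ e n ∘L B ∘L projN θ e n) := by
    rw [hX.comp_projN hω hk hθ hm₀ hB hn]
    simp only [ContinuousLinearMap.comp_add, ContinuousLinearMap.comp_sub]
    rw [← ContinuousLinearMap.comp_assoc (projN θ e n) (transΓm ω k θ e m X ∘L projN θ e n)
        (B ∘L projN θ e n),
      ← ContinuousLinearMap.comp_assoc (projN θ e n) (transΓm ω k θ e m X ∘L projN θ e n)
        (B ∘L (transΓm ω k θ e m X ∘L projN θ e n)), hPY]
    simp only [ContinuousLinearMap.zero_comp]
    abel
  rw [hS] at hL hg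
  have hβ := (isHilbertSchmidt_sub_projN_comp (n := n) hθ hBP.1).1
  set Y := transΓm ω k θ e m X ∘L projN θ e n
  set b := hsNorm e B
  set t := hsNorm e Y
  set β := hsNorm e (B ∘L projN θ e n - projN θ e n ∘L B ∘L projN θ e n)
  have hb : 0 ≤ b := hsNorm_nonneg
  have ht0 : 0 ≤ t := hsNorm_nonneg
  have hBY := hB.comp hY.1
  have h1 := isHilbertSchmidt_sub_projN_comp (n := n) hθ hBY.1
  have h2 := hY.1.comp hBP.1
  have h3 := hY.1.comp hBY.1
  have s1 := h1.1.sub h2.1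
  have s2 := s1.1.sub h3.1
  have s3 := s2.1.add hβ
  have b2 : hsNorm e (Y ∘L (B ∘L projN θ e n)) ≤ t * b :=
    h2.2.trans (mul_le_mul_of_nonneg_left hBP.2 ht0)
  have b3 : hsNorm e (Y ∘L (B ∘L Y)) ≤ 1 / 2 * (b * t) :=
    h3.2.trans (mul_le_mul ht hBY.2 hsNorm_nonneg (by norm_num))
  have b1 : hsNorm e (B ∘L Y - projN θ e n ∘L (B ∘L Y)) ≤ b * t := h1.2.trans hBY.2
  have hS' := s3.2.trans (add_le_add_left (s2.2.trans (add_le_add_left s1.2 _)) _)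
  have hgt : 8 * b * t ≤ gapBound ω k θ m * t := mul_le_mul_of_nonneg_right hgap.le ht0
  have hbt : 0 ≤ b * t := mul_nonneg hb ht0
  -- The off-diagonal part is at most `(5/2) b t + β`. By the block gap `8 b t` is bounded by the
  -- same quantity, so `(11/2) b t ≤ β` and the total is below `2 β`.
  have hfin : Real.pi ^ (2 * k) / ω ^ (2 * k) * (4 * n * (2 * (n : ℝ) + θ) ^ (2 * k - 2)) * t ≤
      2 * β := by
    linarith
  rw [mul_comm, ← le_div_iff₀ (by positivity)] at hfin
  refine hfin.trans (le_of_eq ?_)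
  field_simp
  ring

/-- On the block, `X` has the entries of `B + B Γ_m X`, so `C` collects those of `-B Γ_m X`. They do
not change in norm when `B Γ_m X` is replaced by `(ℙ_n B - ℙ_n B ℙ_n)(Γ_m X ℙ_n)`, because `ℙ_n Γ_m
X ℙ_n = 0`. -/
theorem IsSolution.exists_matrix {A : H →ₗ.[ℂ] H} (hA : IsUnperturbed ω k θ e A)
    (hgap : 8 * hsNorm e B < gapBound ω k θ m) (hX : IsSolution ω k θ e m B X) :
    ∃ C : Matrix (Fin 2) (Fin 2) ℂ,
      sigmaN θ e A X n =
        spectrum ℂ (((lam ω k θ n : ℝ) : ℂ) • (1 : Matrix (Fin 2) (Fin 2) ℂ)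
          - matB θ e B n + C) ∧
      matHSNorm C ≤
        ω ^ (2 * k) / (2 * Real.pi ^ (2 * k) * n * (2 * (n : ℝ) + θ) ^ (2 * k - 2)) *
          hsNorm e (projN θ e n ∘L B - projN θ e n ∘L B ∘L projN θ e n) *
          hsNorm e (B ∘L projN θ e n - projN θ e n ∘L B ∘L projN θ e n) := by
  have hG := (hX.1.transΓm (e := e) hω hk hθ hm₀).1
  have hBG := (hB.comp hG).1
  set f : Fin 2 → ℤ := ![-(n : ℤ) - θ, (n : ℤ)] with hf
  have hfinj : Function.Injective f := by
    intro a b hab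
    fin_cases a <;> fin_cases b <;> simp [hf] at hab ⊢ <;> omega
  have hcls : ∀ a, cls θ (f a) = n := fun a => by
    rw [cls_eq_iff hθ]
    fin_cases a <;> simp [hf]
  have hblk : ∀ a b, blk θ m (f a) = blk θ m (f b) := fun a b => by
    unfold blk; rw [hcls, hcls]
  have hlam : ∀ a, lam ω k θ (f a) = lam ω k θ n := fun a => by rw [← lam_cls hθ, hcls]
  have hentry : ∀ a b, ⟪e (f a), X (e (f b))⟫_ℂ = ⟪e (f a), B (e (f b))⟫_ℂ +
      ⟪e (f a), (B ∘L transΓm ω k θ e m X) (e (f b))⟫_ℂ := fun a b => by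
    have h1 := congrArg (fun T : H →L[ℂ] H => ⟪e (f a), T (e (f b))⟫_ℂ)
      (hX.transJm_eq hω hk hθ hm₀ hB)
    simpa only [add_apply, inner_add_right, entry_transJm m hθ hX.1, entry_transJm m hθ hB,
      entry_transJm m hθ hBG, if_pos (hblk a b)] using h1
  refine ⟨Matrix.of fun a b => -⟪e (f a), (B ∘L transΓm ω k θ e m X) (e (f b))⟫_ℂ, ?_, ?_⟩
  · unfold sigmaN
    rw [hA.compressedSpectrum_eq_spectrum (isCoordProj_projN hθ n) hfinj
      (by ext i; simp [hf, eq_comm])]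
    congr 1
    ext a b
    have hmatB : matB θ e B n a b = ⟪e (f a), B (e (f b))⟫_ℂ := by
      fin_cases a <;> fin_cases b <;> rfl
    rw [Matrix.add_apply, Matrix.sub_apply, hmatB, Matrix.smul_apply, Matrix.one_apply,
      Matrix.of_apply, Matrix.of_apply, hentry, hlam]
    simp only [smul_eq_mul, mul_ite, mul_one, mul_zero]
    ring
  · have hW : IsHilbertSchmidt e (projN θ e n ∘L B - projN θ e n ∘L B ∘L projN θ e n) := by
      refine (hB.of_entry_le zero_le_one fun i j => ?_).1
      rw [sub_apply, inner_sub_right, entry_projN_comp hθ, ContinuousLinearMap.comp_apply,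
        inner_projN hθ]
      split_ifs <;> simp_all
    have hY := isHilbertSchmidt_comp_projN (n := n) hθ hG
    have hWY := hW.comp hY.1
    have hle := matHSNorm_le_hsNorm hWY.1 hfinj
      (C := Matrix.of fun a b => -⟪e (f a), (B ∘L transΓm ω k θ e m X) (e (f b))⟫_ℂ)
      fun a b => by
        have hb : projN θ e n (e (f b)) = e (f b) := by rw [projN_basis hθ, if_pos (hcls b)]
        have hPY : projN θ e n ((transΓm ω k θ e m X) (projN θ e n (e (f b)))) = 0 :=
          congrArg (fun T : H →L[ℂ] H => T (e (f b)))
            (projN_comp_transΓm_comp_projN (m := m) hω hk hθ hn hX.1)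
        rw [hb] at hPY
        rw [Matrix.of_apply, norm_neg]
        simp only [ContinuousLinearMap.comp_apply, sub_apply, hb, hPY, map_zero, sub_zero,
          inner_projN hθ, hcls, if_true, le_refl]
    refine hle.trans (hWY.2.trans ?_)
    have := mul_le_mul_of_nonneg_left
      (hX.hsNorm_transΓm_comp_projN_le hω hk hθ hm₀ hB hn hgap)
      (hsNorm_nonneg (g := e) (X := projN θ e n ∘L B - projN θ e n ∘L B ∘L projN θ e n))
    refine this.trans (le_of_eq ?_)
    ring

end MatrixEstimate

end SimilarOperators

end

/-! ### The theorem. -/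

open SimilarOperators in
theorem mainTheorem9 {H : Type*} [NormedAddCommGroup H] [InnerProductSpace ℂ H] [CompleteSpace H]
    (ω : ℝ) (hω : 0 < ω) (k : ℕ) (hk : 1 < k) (θ : ℕ) (hθ : θ = 0 ∨ θ = 1)
    (e : HilbertBasis ℤ ℂ H) (A : H →ₗ.[ℂ] H) (hA : IsUnperturbed ω k θ e A)
    (B : H →L[ℂ] H) (hB : IsHilbertSchmidt e B)
    (m : ℕ) (hm₀ : 0 < 2 * m + θ)
    (hm : ω ^ (2 * k) * hsNorm e B /
      (Real.pi ^ (2 * k) * (2 * (m : ℝ) + 1) * (2 * (m : ℝ) + θ) ^ (2 * k - 2)) < 1) :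
    (∃! X : H →L[ℂ] H, IsSolution ω k θ e m B X) ∧
    ∀ X : H →L[ℂ] H, IsSolution ω k θ e m B X →
      pSpectrum (subBounded A B) =
        (sigmaLow θ e A X m ∪ ⋃ n ∈ Set.Ici (m + 1), sigmaN θ e A X n) ∧
      (∀ n, m + 1 ≤ n → Disjoint (sigmaLow θ e A X m) (sigmaN θ e A X n)) ∧
      (∀ n n', m + 1 ≤ n → m + 1 ≤ n' → n ≠ n' →
        Disjoint (sigmaN θ e A X n) (sigmaN θ e A X n')) ∧
      (sigmaLow θ e A X m).encard ≤ (2 * m + 1 + θ : ℕ) ∧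
      (∀ n, m + 1 ≤ n → (sigmaN θ e A X n).encard ≤ 2) ∧
      ∀ n, m + 1 ≤ n → ∃ C : Matrix (Fin 2) (Fin 2) ℂ,
        sigmaN θ e A X n =
          spectrum ℂ (((lam ω k θ n : ℝ) : ℂ) • (1 : Matrix (Fin 2) (Fin 2) ℂ)
            - matB θ e B n + C) ∧
        (max ((m : ℝ) + 1) ((3 * hsNorm e B * ω ^ (2 * k) * (Real.pi ^ (2 * k))⁻¹ / 2) ^
            (1 / (2 * (k : ℝ) - 1))) ≤ (n : ℝ) →
          matHSNorm C ≤
            ω ^ (2 * k) / (2 * Real.pi ^ (2 * k) * n * (2 * (n : ℝ) + θ) ^ (2 * k - 2)) *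
              hsNorm e (projN θ e n ∘L B - projN θ e n ∘L B ∘L projN θ e n) *
              hsNorm e (B ∘L projN θ e n - projN θ e n ∘L B ∘L projN θ e n)) := by
  have hgap : 8 * hsNorm e B < gapBound ω k θ m := eight_mul_lt_gapBound hω hm₀ hm
  refine ⟨existsUnique_isSolution hω hk hθ hm₀ hB hgap, fun X hX => ?_⟩
  -- In the ball `‖X‖ ≤ 4 ‖B‖₂`, so the inequality `8 ‖B‖₂ < gapBound` also separates the blocks.
  have hXn : 2 * ‖X‖ < gapBound ω k θ m := by
    linarith [hX.1.norm_le, hsNorm_le_of_ball hB hX.1 hX.2.1]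
  have hlow : sigmaLow θ e A X m = compressedSpectrum A (projBlk θ e m m) X := by
    rw [projBlk, if_pos rfl, sigmaLow]
  have hhigh : ∀ n, m + 1 ≤ n → sigmaN θ e A X n = compressedSpectrum A (projBlk θ e m n) X :=
    fun n hn => by rw [projBlk, if_neg (by omega), sigmaN]
  refine ⟨?_, fun n hn => ?_, fun n n' hn hn' hne => ?_, ?_, fun n _ => ?_, fun n hn => ?_⟩
  · rw [hX.pSpectrum_eq hω hk hθ hm₀ hB hA hgap]
    ext z
    rw [Set.mem_ofPred_eq, hA.eigenvalues_transJm hθ hX.1, Set.mem_union, Set.mem_iUnion₂]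
    constructor
    · rintro ⟨s, hs, hz⟩
      rcases hs.eq_or_lt with rfl | hlt
      · exact Or.inl (hlow ▸ hz)
      · exact Or.inr ⟨s, hlt, by rwa [hhigh s hlt]⟩
    · rintro (hz | ⟨s, hs, hz⟩)
      · exact ⟨m, le_rfl, hlow ▸ hz⟩
      · exact ⟨s, (Nat.le_succ m).trans hs, by rwa [← hhigh s hs]⟩
  · rw [hlow, hhigh n hn]
    exact hA.disjoint_blocks hω hk hθ hXn le_rfl (by omega) (by omega)
  · rw [hhigh n hn, hhigh n' hn']
    exact hA.disjoint_blocks hω hk hθ hXn (by omega) (by omega) hne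
  · refine (hA.encard_compressedSpectrum_le (isCoordProj_projUpTo hθ m)).trans ?_
    rw [Int.card_Icc]
    exact_mod_cast (by omega : ((m : ℤ) + 1 - (-(m : ℤ) - θ)).toNat ≤ 2 * m + 1 + θ)
  · refine (hA.encard_compressedSpectrum_le (isCoordProj_projN hθ n)).trans ?_
    exact_mod_cast Finset.card_le_two
  · obtain ⟨C, hC, hCn⟩ := hX.exists_matrix hω hk hθ hm₀ hB hn hA hgap
    exact ⟨C, hC, fun _ => hCn⟩
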